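/- Let $d\ge 2$, let $\mathbb T^d=(\mathbb R/2\pi\mathbb Z)^d$ carry Lebesgue measure, and let $\mathcal F:\ell^2(\mathbb Z^d)\to L^2(\mathbb T^d)$, $(\mathcal F\phi)(k)=(2\pi)^{-d/2}\sum_{n\in\mathbb Z^d}e^{-\imath k\cdot n}\phi_n$, be the unitary Fourier transform. Let $H=H^*$ be a bounded, translation invariant operator on $\ell^2(\mathbb Z^d,\mathbb C)$, that is, $\langle n+l|H|m+l\rangle=\langle n|H|m\rangle$ for all $n,m,l\in\mathbb Z^d$, such that $\mathcal F H\mathcal F^*$ is multiplication by a real analytic function $\mathcal E:\mathbb T^d\to\mathbb R$. Let $\rho:\mathbb T^d\to[0,1]$ be a smooth function whose (closed) support contains no critical point of $\mathcal E$, i.e. $\nabla\mathcal E(k)\neq 0$ for all $k\in\operatorname{supp}\rho$. Let $\langle X\rangle^{-\alpha}$ be multiplication by $(1+|n|^2)^{-\alpha/2}$ on $\ell^2(\mathbb Z^d)$ ($|n|$ the euclidean length), and for non-real $z$ put $$\mathcal R^z_{\rho,\alpha}=\langle X\rangle^{-\alpha}\,\mathcal F^*\rho\,\mathcal F\,(H-z)^{-1}\langle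 X\rangle^{-\alpha}.$$ Let $\alpha>\tfrac12$. Then for every $E\in\mathbb R$ and for both choices of the sign the limit $$\mathcal R^{E\pm\imath 0}_{\rho,\alpha}=\lim_{\epsilon\downarrow 0}\mathcal R^{E\pm\imath\epsilon}_{\rho,\alpha}$$ exists in operator norm. Moreover, for every $\beta$ with $0<\beta<1$ and $\beta<\alpha-\tfrac12$ there is a constant $C_\beta$ such that for all $E,E'\in\mathbb R$ $$\big\|\mathcal R^{E\pm\imath 0}_{\rho,\alpha}-\mathcal R^{E'\pm\imath 0}_{\rho,\alpha}\big\|\le C_\beta\,|E-E'|^\beta .$$ -/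

import Mathlib

open scoped ENNReal ComplexConjugate

noncomputable section

namespace LAP

instance instTwoPiPos : Fact (0 < 2 * Real.pi) := ⟨Real.two_pi_pos⟩

/-- The Brillouin torus `(ℝ / 2πℤ)^d`.  Its `volume` is the product of the Lebesgue measures on the
circles `ℝ / 2πℤ` of length `2π`, so the torus has total mass `(2π)^d`. -/
abbrev Torus (d : ℕ) : Type := Fin d → AddCircle (2 * Real.pi)

/-- The Hilbert space `ℓ²(ℤ^d, ℂ)`. -/
abbrev Ell2 (d : ℕ) : Type := lp (fun _ : Fin d → ℤ => ℂ) 2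

/-- The Hilbert space `L²(𝕋^d, ℂ)` with respect to Lebesgue measure. -/
abbrev L2Torus (d : ℕ) : Type := MeasureTheory.Lp ℂ 2 (MeasureTheory.volume : MeasureTheory.Measure (Torus d))

/-- The vector `|n⟩` of `ℓ²(ℤ^d)`, localized at the site `n`. -/
def ket {d : ℕ} (n : Fin d → ℤ) : Ell2 d := lp.single 2 n (1 : ℂ)

/-! ### The Fourier transform -/

/-- The exponential `k ↦ e^{-i k·n}` on the torus. -/
def expo {d : ℕ} (n : Fin d → ℤ) : C(Torus d, ℂ) where
  toFun k := ∏ i, fourier (-(n i)) (k i)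
  continuous_toFun := by fun_prop

theorem expo_apply_coe {d : ℕ} (n : Fin d → ℤ) (x : Fin d → ℝ) :
    expo n (fun i => (x i : AddCircle (2 * Real.pi)))
      = Complex.exp (-Complex.I * ∑ i, (x i : ℂ) * (n i : ℂ)) := by
  have h2 : (Real.pi : ℂ) ≠ 0 := by exact_mod_cast Real.pi_ne_zero
  rw [Finset.mul_sum, Complex.exp_sum]
  change ∏ i, fourier (-(n i)) (x i : AddCircle (2 * Real.pi)) = _
  refine Finset.prod_congr rfl fun i _ => ?_
  rw [fourier_coe_apply]
  congr 1
  push_cast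
  field_simp

theorem expo_zero {d : ℕ} : expo (0 : Fin d → ℤ) = 1 := by
  ext k
  simp [expo]

theorem expo_add {d : ℕ} (m n : Fin d → ℤ) (k : Torus d) :
    expo (m + n) k = expo m k * expo n k := by
  simp only [expo, Pi.add_apply, ContinuousMap.coe_mk, neg_add, fourier_add,
    Finset.prod_mul_distrib]

theorem expo_neg {d : ℕ} (n : Fin d → ℤ) (k : Torus d) : expo (-n) k = conj (expo n k) := by
  simp only [expo, Pi.neg_apply, fourier_neg, ContinuousMap.coe_mk, map_prod]

theorem span_expo_closure_eq_top (d : ℕ) :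
    (Submodule.span ℂ (Set.range (expo (d := d)))).topologicalClosure = ⊤ := by
  let S : StarSubalgebra ℂ C(Torus d, ℂ) :=
    { toSubalgebra := Algebra.adjoin ℂ (Set.range (expo (d := d)))
      star_mem' := by
        change Algebra.adjoin ℂ (Set.range (expo (d := d)))
          ≤ star (Algebra.adjoin ℂ (Set.range (expo (d := d))))
        refine Algebra.adjoin_le ?_
        rintro _ ⟨n, rfl⟩
        refine Algebra.subset_adjoin ⟨-n, ?_⟩
        ext1 x
        simp only [expo_neg, starRingEnd_apply, ContinuousMap.star_apply] }
  have hspan : S.toSubalgebra.toSubmodule = Submodule.span ℂ (Set.range (expo (d := d))) := by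
    apply Algebra.adjoin_eq_span_of_subset
    refine .trans (fun x ↦ Submonoid.closure_induction (fun _ ↦ id) ⟨0, expo_zero⟩ ?_)
      Submodule.subset_span
    rintro _ _ _ _ ⟨m, rfl⟩ ⟨n, rfl⟩
    refine ⟨m + n, ?_⟩
    ext z
    exact expo_add m n z
  have hsep : S.SeparatesPoints := by
    intro x y hxy
    rw [Ne, funext_iff, not_forall] at hxy
    obtain ⟨i, hi⟩ := hxy
    refine ⟨_, ⟨expo (Pi.single i (-1)), Algebra.subset_adjoin ⟨Pi.single i (-1), rfl⟩, rfl⟩, ?_⟩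
    have key : ∀ z : Torus d, expo (Pi.single i (-1)) z = (AddCircle.toCircle (z i) : ℂ) := by
      intro z
      change ∏ j, fourier (-((Pi.single i (-1) : Fin d → ℤ) j)) (z j) = _
      rw [Finset.prod_eq_single i]
      · simp
      · intro j _ hj
        simp [Pi.single_eq_of_ne hj]
      · simp
    change expo (Pi.single i (-1)) x ≠ expo (Pi.single i (-1)) y
    rw [key, key]
    intro h
    exact hi (AddCircle.injective_toCircle Real.two_pi_pos.ne' (Circle.ext h))
  rw [← hspan]
  exact congr_arg (Subalgebra.toSubmodule <| StarSubalgebra.toSubalgebra ·)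
    (ContinuousMap.starSubalgebra_topologicalClosure_eq_top_of_separatesPoints S hsep)

/-- The normalized exponential `k ↦ (2π)^{-d/2} e^{-i k·n}` as an element of `L²(𝕋^d)`. -/
def expoL2 {d : ℕ} (n : Fin d → ℤ) : L2Torus d :=
  ContinuousMap.toLp (E := ℂ) 2 MeasureTheory.volume ℂ
    ((((2 * Real.pi) ^ (-(d : ℝ) / 2) : ℝ) : ℂ) • expo n)

theorem integral_expo {d : ℕ} (n : Fin d → ℤ) :
    ∫ k : Torus d, expo n k = if n = 0 then (((2 * Real.pi) ^ d : ℝ) : ℂ) else 0 := by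
  have h1 : ∀ m : ℤ, ∫ x : AddCircle (2 * Real.pi), fourier m x
      = if m = 0 then ((2 * Real.pi : ℝ) : ℂ) else 0 := by
    intro m
    split_ifs with h
    · subst h
      simp [MeasureTheory.measureReal_def, AddCircle.measure_univ, Real.pi_pos.le]
    · exact MeasureTheory.integral_eq_zero_of_add_right_eq_neg
        (fourier_add_half_inv_index h Real.two_pi_pos)
  change ∫ k : Torus d, ∏ i, fourier (-(n i)) (k i) = _
  rw [MeasureTheory.integral_fintype_prod_volume_eq_prod
    (f := fun i (x : AddCircle (2 * Real.pi)) => fourier (-(n i)) x)]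
  simp only [h1]
  split_ifs with h
  · subst h
    simp
  · obtain ⟨i, hi⟩ := Function.ne_iff.mp h
    exact Finset.prod_eq_zero (Finset.mem_univ i) (by simpa using hi)

theorem orthonormal_expoL2 (d : ℕ) : Orthonormal ℂ (expoL2 (d := d)) := by
  rw [orthonormal_iff_ite]
  intro m n
  have hpi : (0 : ℝ) < 2 * Real.pi := Real.two_pi_pos
  have hc : ((2 * Real.pi) ^ (-(d : ℝ) / 2) : ℝ) * (2 * Real.pi) ^ (-(d : ℝ) / 2)
      * (2 * Real.pi) ^ d = 1 := by
    rw [← Real.rpow_natCast, ← Real.rpow_add hpi, ← Real.rpow_add hpi]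
    ring_nf
    exact Real.rpow_zero _
  rw [expoL2, expoL2, map_smul, map_smul, inner_smul_left, inner_smul_right,
    MeasureTheory.ContinuousMap.inner_toLp]
  simp only [← expo_neg, ← expo_add]
  rw [integral_expo, Complex.conj_ofReal]
  by_cases h : m = n
  · subst h
    simp only [add_neg_cancel, if_true]
    rw [← mul_assoc]
    exact_mod_cast hc
  · have h' : ¬ (n + -m = 0) := fun h0 => h (by rw [← sub_eq_add_neg, sub_eq_zero] at h0; exact h0.symm)
    simp [h, h']

theorem span_expoL2_closure_eq_top (d : ℕ) :
    (Submodule.span ℂ (Set.range (expoL2 (d := d)))).topologicalClosure = ⊤ := by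
  have hc : (((2 * Real.pi) ^ (-(d : ℝ) / 2) : ℝ) : ℂ) ≠ 0 := by
    exact_mod_cast (Real.rpow_pos_of_pos Real.two_pi_pos _).ne'
  have hr : Submodule.span ℂ (Set.range (expoL2 (d := d))) = Submodule.span ℂ
      (Set.range (fun n : Fin d → ℤ =>
        (ContinuousMap.toLp (E := ℂ) 2 MeasureTheory.volume ℂ (expo n) : L2Torus d))) := by
    refine le_antisymm (Submodule.span_le.mpr ?_) (Submodule.span_le.mpr ?_)
    · rintro _ ⟨n, rfl⟩
      rw [expoL2, map_smul]
      exact Submodule.smul_mem _ _ (Submodule.subset_span ⟨n, rfl⟩)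
    · rintro _ ⟨n, rfl⟩
      have h := Submodule.smul_mem (Submodule.span ℂ (Set.range (expoL2 (d := d))))
        ((((2 * Real.pi) ^ (-(d : ℝ) / 2) : ℝ) : ℂ)⁻¹) (Submodule.subset_span ⟨n, rfl⟩)
      rwa [expoL2, map_smul, smul_smul, inv_mul_cancel₀ hc, one_smul] at h
  rw [hr]
  simpa only [Submodule.map_span, ContinuousLinearMap.coe_coe, ← Set.range_comp,
    Function.comp_def] using
    (ContinuousMap.toLp_denseRange ℂ MeasureTheory.volume ℂ
      (by simp : (2 : ℝ≥0∞) ≠ ∞)).topologicalClosure_map_submodule (span_expo_closure_eq_top d)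

/-- The orthonormal basis `(2π)^{-d/2} e^{-i k·n}`, `n ∈ ℤ^d`, of `L²(𝕋^d)`. -/
def expoBasis (d : ℕ) : HilbertBasis (Fin d → ℤ) ℂ (L2Torus d) :=
  HilbertBasis.mk (orthonormal_expoL2 d) (span_expoL2_closure_eq_top d).ge

/-- The unitary Fourier transform `ℱ : ℓ²(ℤ^d) → L²(𝕋^d)`,
`(ℱ φ)(k) = (2π)^{-d/2} ∑ₙ e^{-i k·n} φₙ`. -/
def fourierT (d : ℕ) : Ell2 d ≃ₗᵢ[ℂ] L2Torus d := (expoBasis d).repr.symm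

theorem fourierT_ket {d : ℕ} (n : Fin d → ℤ) : fourierT d (ket n) = expoL2 n := by
  have h := (expoBasis d).repr_symm_single n
  rw [expoBasis, HilbertBasis.coe_mk] at h
  exact h

theorem hasSum_fourierT {d : ℕ} (φ : Ell2 d) :
    HasSum (fun n => φ n • expoL2 n) (fourierT d φ) := by
  have h := (expoBasis d).hasSum_repr_symm φ
  rw [expoBasis, HilbertBasis.coe_mk] at h
  exact h

/-! ### Operators -/

/-- The operator on `L²(𝕋^d)` of multiplication by a continuous real function. -/
def mulOp {d : ℕ} (f : C(Torus d, ℝ)) : L2Torus d →L[ℂ] L2Torus d :=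
  (ContinuousLinearMap.mul ℂ ℂ).holderL MeasureTheory.volume ∞ 2 2
    (ContinuousMap.toLp (E := ℂ) ∞ MeasureTheory.volume ℂ
      ⟨fun k => (f k : ℂ), Complex.continuous_ofReal.comp f.continuous⟩)

theorem mulOp_ae_eq {d : ℕ} (f : C(Torus d, ℝ)) (φ : L2Torus d) :
    mulOp f φ =ᵐ[MeasureTheory.volume] fun k => (f k : ℂ) * φ k := by
  have h1 := ContinuousLinearMap.coeFn_holder (r := 2) (ContinuousLinearMap.mul ℂ ℂ)
    (ContinuousMap.toLp (E := ℂ) ∞ (MeasureTheory.volume : MeasureTheory.Measure (Torus d)) ℂ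
      ⟨fun k => (f k : ℂ), Complex.continuous_ofReal.comp f.continuous⟩) φ
  have h2 := ContinuousMap.coeFn_toLp (p := ∞) (𝕜 := ℂ)
    (MeasureTheory.volume : MeasureTheory.Measure (Torus d))
    (⟨fun k => (f k : ℂ), Complex.continuous_ofReal.comp f.continuous⟩ : C(Torus d, ℂ))
  refine h1.trans ?_
  filter_upwards [h2] with k hk
  rw [hk]
  rfl

/-- The operator `ℱ* f ℱ` on `ℓ²(ℤ^d)`, for a continuous real function `f` on the torus. -/
def fourierMultiplier {d : ℕ} (f : C(Torus d, ℝ)) : Ell2 d →L[ℂ] Ell2 d :=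
  ((fourierT d).symm.toContinuousLinearEquiv : L2Torus d →L[ℂ] Ell2 d) ∘L mulOp f ∘L
    ((fourierT d).toContinuousLinearEquiv : Ell2 d →L[ℂ] L2Torus d)

/-- `H` is translation invariant: `⟨n+l|H|m+l⟩ = ⟨n|H|m⟩` for all `n, m, l`. -/
def TranslationInvariant {d : ℕ} (H : Ell2 d →L[ℂ] Ell2 d) : Prop :=
  ∀ n m l : Fin d → ℤ,
    inner ℂ (ket (n + l)) (H (ket (m + l))) = inner ℂ (ket n) (H (ket m))

/-- `ℰ` is the symbol (energy band) of `H`: `ℱ H ℱ*` is multiplication by `ℰ`. -/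
def HasSymbol {d : ℕ} (H : Ell2 d →L[ℂ] Ell2 d) (ℰ : C(Torus d, ℝ)) : Prop :=
  ((fourierT d).toContinuousLinearEquiv : Ell2 d →L[ℂ] L2Torus d) ∘L H ∘L
    ((fourierT d).symm.toContinuousLinearEquiv : L2Torus d →L[ℂ] Ell2 d) = mulOp ℰ

/-- `⟨n⟩ = (1 + |n|²)^{1/2}` with the euclidean length `|n|`. -/
def japanese {d : ℕ} (n : Fin d → ℤ) : ℝ := Real.sqrt (1 + ∑ i, (n i : ℝ) ^ 2)

theorem one_le_japanese {d : ℕ} (n : Fin d → ℤ) : 1 ≤ japanese n := by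
  rw [japanese, Real.one_le_sqrt]
  have : 0 ≤ ∑ i, (n i : ℝ) ^ 2 := Finset.sum_nonneg fun i _ => sq_nonneg _
  linarith

theorem norm_weight_le {d : ℕ} {α : ℝ} (hα : 0 ≤ α) (n : Fin d → ℤ) (c : ℂ) :
    ‖((japanese n ^ (-α) : ℝ) : ℂ) * c‖ ≤ ‖c‖ := by
  have h0 : 0 ≤ japanese n ^ (-α) :=
    Real.rpow_nonneg (zero_le_one.trans (one_le_japanese n)) _
  have h1 : japanese n ^ (-α) ≤ 1 :=
    Real.rpow_le_one_of_one_le_of_nonpos (one_le_japanese n) (by linarith)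
  rw [norm_mul, Complex.norm_real, Real.norm_of_nonneg h0]
  exact mul_le_of_le_one_left (norm_nonneg c) h1

theorem memℓp_weight {d : ℕ} {α : ℝ} (hα : 0 ≤ α) (φ : Ell2 d) :
    Memℓp (fun n : Fin d → ℤ => ((japanese n ^ (-α) : ℝ) : ℂ) * φ n) 2 := by
  have h2 : 0 < (2 : ℝ≥0∞).toReal := by norm_num
  refine memℓp_gen ?_
  refine Summable.of_nonneg_of_le (fun n => by positivity) (fun n => ?_)
    ((lp.memℓp φ).summable h2)
  exact Real.rpow_le_rpow (norm_nonneg _) (norm_weight_le hα n (φ n)) h2.le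

/-- The bounded operator `⟨X⟩^{-α}` on `ℓ²(ℤ^d)`, `α ≥ 0`. -/
def damping (d : ℕ) (α : ℝ) (hα : 0 ≤ α) : Ell2 d →L[ℂ] Ell2 d :=
  LinearMap.mkContinuous
    { toFun := fun φ => ⟨fun n => ((japanese n ^ (-α) : ℝ) : ℂ) * φ n, memℓp_weight hα φ⟩
      map_add' := fun φ ψ => by
        ext n
        exact mul_add _ _ _
      map_smul' := fun c φ => by
        ext n
        exact mul_left_comm _ _ _ }
    1
    (fun φ => by
      rw [one_mul]
      have h2 : 0 < (2 : ℝ≥0∞).toReal := by norm_num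
      rw [lp.norm_eq_tsum_rpow h2, lp.norm_eq_tsum_rpow h2]
      refine Real.rpow_le_rpow (tsum_nonneg fun n => by positivity) ?_ (by norm_num)
      refine Summable.tsum_le_tsum (fun n => ?_) ((memℓp_weight hα φ).summable h2)
        ((lp.memℓp φ).summable h2)
      exact Real.rpow_le_rpow (norm_nonneg _) (norm_weight_le hα n (φ n)) h2.le)

theorem damping_apply {d : ℕ} {α : ℝ} (hα : 0 ≤ α) (φ : Ell2 d) (n : Fin d → ℤ) :
    damping d α hα φ n = ((japanese n ^ (-α) : ℝ) : ℂ) * φ n := rfl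

/-- The resolvent `R^z = (H - z)⁻¹`; it is the true inverse for every `z` outside the spectrum of
`H`, hence for every non-real `z` when `H` is selfadjoint. -/
def resolventOp {d : ℕ} (H : Ell2 d →L[ℂ] Ell2 d) (z : ℂ) : Ell2 d →L[ℂ] Ell2 d :=
  Ring.inverse (H - z • ContinuousLinearMap.id ℂ (Ell2 d))

/-- The localized and damped resolvent `⟨X⟩^{-α} 𝒫_ρ R^z ⟨X⟩^{-α}` with `𝒫_ρ = ℱ* ρ ℱ`. -/
def dampedResolvent {d : ℕ} (H : Ell2 d →L[ℂ] Ell2 d) (ρ : C(Torus d, ℝ)) (α : ℝ) (hα : 0 ≤ α)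
    (z : ℂ) : Ell2 d →L[ℂ] Ell2 d :=
  damping d α hα ∘L (fourierMultiplier ρ ∘L resolventOp H z) ∘L damping d α hα

/-! ### Regularity of functions on the torus -/

/-- The covering map `ℝ^d → 𝕋^d`. -/
def torusProj {d : ℕ} (x : EuclideanSpace ℝ (Fin d)) : Torus d :=
  fun i => (x i : AddCircle (2 * Real.pi))

/-- The `2πℤ^d`-periodic function on `ℝ^d` that represents a function on the torus. -/
def lift {d : ℕ} (f : C(Torus d, ℝ)) : EuclideanSpace ℝ (Fin d) → ℝ := fun x => f (torusProj x)

/-- `k` is a critical point of `f`: the gradient of `f` vanishes at `k`. -/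
def IsCriticalPoint {d : ℕ} (f : C(Torus d, ℝ)) (k : Torus d) : Prop :=
  ∃ x : EuclideanSpace ℝ (Fin d), torusProj x = k ∧ gradient (lift f) x = 0

end LAP

end

namespace LAP

open Complex (I exp)
open intervalIntegral MeasureTheory

/-! ### Uniform bounds for oscillatory Cauchy integrals on the circle -/

/-! In Fourier variables the localized resolvent is multiplication by `ρ / (ℰ - z)`. Since `∇ℰ ≠ 0`
on the support of `ρ`, one can write `ρ = ∑ⱼ gⱼ ∂ⱼℰ` with `gⱼ` smooth and vanishing wherever `|∂ⱼℰ|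
< c` (`exists_smooth_partition`). Each summand is then studied only along coordinate lines in
direction `j`, so the problem becomes one-dimensional, with constants uniform over all lines.

On a line the basic fact is that `∫ a(t) e^{ixt} / (E(t) - z) dt` is bounded uniformly in the
integer `x` and in non-real `z`, provided `|E'| ≥ c` where `a ≠ 0`
(`exists_norm_integral_cauchy_le`). Near a zero of `E - Re z` the integrand is compared with the
linear model `e^{ixv} / (v - iη)`, and this in turn with `i e^{ixv} / (1 - (1 - η) e^{-iv})`, a
geometric series whose integral is explicit.

For the amplitude `g E'` the `z`-derivative of the integral has a double pole, but `g E' / (E - z)²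
= -g (1 / (E - z))'`. Integration by parts restores a simple pole at the cost of a factor `1 + |x|`
(`exists_norm_integral_cauchy_sub_le`). Interpolating between boundedness and this Lipschitz bound
gives `C (1 + |x|)^β |z - z'|^β` for all `0 ≤ β ≤ 1`.

Here `x = p - q` is the difference of the `j`-th coordinates of two lattice slices. Because `1 + |p
- q| ≤ (1 + |p|)(1 + |q|)`, the growth in `x` is shared between the two weights `⟨X⟩^{-α}`, and
Cauchy–Schwarz over slices needs only `∑ₚ (1 + |p|)^{2(β - α)} < ∞`, that is `β < α - 1/2`
(`norm_damping_cmultiplier_damping_le`). The damped resolvent is therefore Hölder continuous in norm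
on each open half plane, and completeness gives Hölder boundary values (`exists_boundary_values`).
-/

theorem integral_exp_int_mul (m : ℤ) :
    ∫ v in (-Real.pi)..Real.pi, exp (I * m * v) = if m = 0 then (2 * Real.pi : ℂ) else 0 := by
  split_ifs with h
  · subst h
    simp
    ring
  · have hm : I * (m : ℂ) ≠ 0 := mul_ne_zero Complex.I_ne_zero (by exact_mod_cast h)
    rw [integral_exp_mul_complex hm, div_eq_zero_iff]
    left
    rw [sub_eq_zero]
    have := (Complex.exp_periodic.int_mul m) (I * m * ((-Real.pi : ℝ) : ℂ))
    rw [← this]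
    congr 1
    push_cast
    ring

theorem norm_exp_I_int_mul (m : ℤ) (v : ℝ) : ‖exp (I * m * v)‖ = 1 := by
  rw [Complex.norm_exp]
  simp

/-- Expanding in powers of `r e^{-iv}` and integrating term by term, only `n = x` survives: the
integral is `2π r^x` for `x ≥ 0` and `0` otherwise. The bound is thus uniform as `r → 1`. -/
theorem norm_integral_exp_div_one_sub_le (x : ℤ) {r : ℝ} (h0 : 0 ≤ r) (h1 : r < 1) :
    ‖∫ v in (-Real.pi)..Real.pi, exp (I * x * v) / (1 - r * exp (-(I * v)))‖ ≤ 2 * Real.pi := by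
  have hpi := Real.pi_pos
  have hexp : ∀ v : ℝ, ‖exp (-(I * v))‖ = 1 := fun v => by rw [Complex.norm_exp]; simp
  have key : HasSum (fun n : ℕ => ∫ v in (-Real.pi)..Real.pi, (r : ℂ) ^ n * exp (I * (x - n : ℤ) * v))
      (∫ v in (-Real.pi)..Real.pi, exp (I * x * v) / (1 - r * exp (-(I * v)))) := by
    refine intervalIntegral.hasSum_integral_of_dominated_convergence (fun n _ => r ^ n)
      (fun n => ?_) (fun n => ?_) ?_ ?_ ?_
    · exact (Continuous.aestronglyMeasurable (by fun_prop))
    · refine Filter.Eventually.of_forall fun t _ => ?_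
      rw [norm_mul, norm_exp_I_int_mul, norm_pow, Complex.norm_real, Real.norm_of_nonneg h0, mul_one]
    · exact Filter.Eventually.of_forall fun t _ => summable_geometric_of_lt_one h0 h1
    · exact intervalIntegrable_const
    · refine Filter.Eventually.of_forall fun t _ => ?_
      have hr : ‖(r : ℂ) * exp (-(I * t))‖ < 1 := by
        rw [norm_mul, hexp, Complex.norm_real, Real.norm_of_nonneg h0, mul_one]; exact h1
      have := (hasSum_geometric_of_norm_lt_one hr).mul_left (exp (I * x * t))
      rw [div_eq_mul_inv]
      refine this.congr_fun fun n => ?_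
      rw [mul_pow, ← Complex.exp_nat_mul, mul_left_comm, ← Complex.exp_add]
      congr 2
      push_cast
      ring
  have hterm : ∀ n : ℕ, ∫ v in (-Real.pi)..Real.pi, (r : ℂ) ^ n * exp (I * (x - n : ℤ) * v)
      = if x = n then (r : ℂ) ^ n * (2 * Real.pi) else 0 := by
    intro n
    rw [intervalIntegral.integral_const_mul, integral_exp_int_mul]
    simp only [sub_eq_zero, mul_ite, mul_zero]
  simp only [hterm] at key
  rcases lt_or_ge x 0 with hx | hx
  · have : ∀ n : ℕ, ¬ (x = n) := fun n => by omega
    simp only [this, if_false] at key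
    rw [key.unique hasSum_zero, norm_zero]
    positivity
  · lift x to ℕ using hx
    have h2 := hasSum_single (f := fun n : ℕ => if ((x : ℤ) = n) then (r : ℂ) ^ n * (2 * Real.pi) else 0) x
      (fun n hn => if_neg (by exact_mod_cast hn.symm))
    rw [key.unique h2, if_pos rfl, norm_mul, norm_pow, Complex.norm_real, Real.norm_of_nonneg h0]
    have h3 : ‖(2 * Real.pi : ℂ)‖ = 2 * Real.pi := by
      rw [norm_mul, Complex.norm_real, Real.norm_of_nonneg hpi.le]; simp
    rw [h3]
    exact mul_le_of_le_one_left (by positivity) (pow_le_one₀ h0 h1.le)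

theorem norm_exp_sub_one_sub_le (v : ℝ) : ‖exp (-(I * v)) - 1 + I * v‖ ≤ 2 * v ^ 2 := by
  have hn : ‖-(I * (v : ℂ))‖ = |v| := by simp
  rcases le_or_gt |v| 1 with h | h
  · have := Complex.norm_exp_sub_one_sub_id_le (x := -(I * v)) (by rw [hn]; exact h)
    rw [hn, sq_abs, sub_neg_eq_add] at this
    nlinarith [sq_nonneg v]
  · have h1 : ‖exp (-(I * v)) - 1‖ ≤ |v| := by
      have := Real.norm_exp_I_mul_ofReal_sub_one_le (x := -v)
      simpa using this
    have h2 : ‖I * (v : ℂ)‖ = |v| := by simp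
    have := norm_add_le (exp (-(I * v)) - 1) (I * v)
    have h3 : v ^ 2 = |v| ^ 2 := (sq_abs v).symm
    nlinarith

/-- Jordan's inequality gives `|e^{-iv} - 1| ≥ 2|v|/π`, and replacing `1` by `r` costs at most `1 -
r`, itself bounded by the right-hand side; this loses only a factor two. -/
theorem abs_le_norm_one_sub_mul_exp {r v : ℝ} (h0 : 0 ≤ r) (h1 : r ≤ 1) (hv : |v| ≤ Real.pi) :
    |v| / Real.pi ≤ ‖1 - r * exp (-(I * v))‖ := by
  have hexp : ‖exp (-(I * v))‖ = 1 := by rw [Complex.norm_exp]; simp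
  have e1 : ‖exp (-(I * v)) - 1‖ = 2 * |Real.sin (v / 2)| := by
    have := Complex.norm_exp_I_mul_ofReal_sub_one (-v)
    rw [Complex.ofReal_neg, mul_neg] at this
    rw [this, neg_div, Real.sin_neg]
    simp
  have e2 : 2 / Real.pi * |v / 2| ≤ |Real.sin (v / 2)| := by
    apply Real.mul_abs_le_abs_sin
    rw [abs_div, abs_two]
    linarith
  have e3 : ‖exp (-(I * v)) - 1‖ ≤ ‖1 - r * exp (-(I * v))‖ + (1 - r) := by
    have : exp (-(I * v)) - 1 = -(1 - r * exp (-(I * v))) + ((1 - r : ℝ) : ℂ) * exp (-(I * v)) := by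
      push_cast; ring
    rw [this]
    refine (norm_add_le _ _).trans ?_
    rw [norm_neg, norm_mul, hexp, Complex.norm_real, Real.norm_of_nonneg (by linarith), mul_one]
  have e4 : 1 - r ≤ ‖1 - r * exp (-(I * v))‖ := by
    have := norm_sub_norm_le (1 : ℂ) (r * exp (-(I * v)))
    rwa [norm_mul, hexp, Complex.norm_real, Real.norm_of_nonneg h0, mul_one, norm_one] at this
  rw [abs_div, abs_two] at e2
  have : |v| / Real.pi = 2 / Real.pi * (|v| / 2) := by ring
  linarith

theorem sub_mul_I_ne_zero (v : ℝ) {η : ℝ} (hη : η ≠ 0) : (v : ℂ) - η * I ≠ 0 := by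
  intro h
  have := congrArg Complex.im h
  simp at this
  exact hη this

theorem abs_le_norm_sub_mul_I (v η : ℝ) : |v| ≤ ‖(v : ℂ) - η * I‖ := by
  have := Complex.abs_re_le_norm ((v : ℂ) - η * I)
  simpa using this

theorem abs_le_norm_sub_mul_I' (v η : ℝ) : |η| ≤ ‖(v : ℂ) - η * I‖ := by
  have := Complex.abs_im_le_norm ((v : ℂ) - η * I)
  simpa using this

/-- To first order `1 - (1 - η) e^{-iv}` equals `η + iv = i (v - iη)`, so the poles match. The error
in the numerator is of order `v² + η|v|`, which the product of the two denominators absorbs. -/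
theorem norm_cauchy_sub_geometric_le {v η : ℝ} (h0 : 0 < η) (h1 : η ≤ 1) (hv : |v| ≤ Real.pi) :
    ‖1 / ((v : ℂ) - η * I) - I / (1 - (1 - η : ℝ) * exp (-(I * v)))‖ ≤ 3 * Real.pi := by
  have hpi := Real.pi_pos
  rcases eq_or_ne v 0 with rfl | hv0
  · have : (η : ℂ) ≠ 0 := by exact_mod_cast h0.ne'
    have h : 1 / (((0 : ℝ) : ℂ) - η * I) - I / (1 - (1 - η : ℝ) * exp (-(I * (0 : ℝ)))) = 0 := by
      simp [div_eq_mul_inv]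
    rw [h, norm_zero]
    positivity
  have hvp : 0 < |v| := abs_pos.mpr hv0
  have hne := sub_mul_I_ne_zero v h0.ne'
  have hD := abs_le_norm_one_sub_mul_exp (r := 1 - η) (by linarith) (by linarith) hv
  set D : ℂ := 1 - (1 - η : ℝ) * exp (-(I * v)) with hDdef
  have hDpos : 0 < ‖D‖ := lt_of_lt_of_le (by positivity) hD
  have hDne : D ≠ 0 := norm_pos_iff.mp hDpos
  have heq : 1 / ((v : ℂ) - η * I) - I / D
      = (-(exp (-(I * v)) - 1 + I * v) + η * (exp (-(I * v)) - 1)) / (((v : ℂ) - η * I) * D) := by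
    rw [div_sub_div _ _ hne hDne]
    congr 1
    rw [hDdef]
    push_cast
    linear_combination (η : ℂ) * Complex.I_sq
  have hexp1 : ‖exp (-(I * v)) - 1‖ ≤ |v| := by
    have := Real.norm_exp_I_mul_ofReal_sub_one_le (x := -v)
    simpa using this
  have hnum : ‖-(exp (-(I * v)) - 1 + I * v) + η * (exp (-(I * v)) - 1)‖ ≤ 2 * |v| ^ 2 + η * |v| := by
    refine (norm_add_le _ _).trans ?_
    rw [norm_neg, norm_mul, Complex.norm_real, Real.norm_of_nonneg h0.le, sq_abs]
    gcongr
    exact norm_exp_sub_one_sub_le v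
  rw [heq, norm_div, norm_mul, div_le_iff₀ (by positivity)]
  refine hnum.trans ?_
  have hn1 := abs_le_norm_sub_mul_I v η
  have hn2 := abs_le_norm_sub_mul_I' v η
  rw [abs_of_pos h0] at hn2
  have hD' : |v| ≤ ‖D‖ * Real.pi := (div_le_iff₀ hpi).mp hD
  calc 2 * |v| ^ 2 + η * |v| = (2 * |v| + η) * |v| := by ring
    _ ≤ (3 * ‖(v : ℂ) - η * I‖) * (‖D‖ * Real.pi) := by gcongr; linarith
    _ = _ := by ring

/-- The constant bounding the Cauchy integrals of exponentials over a symmetric period. -/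
noncomputable def cauchyConst : ℝ := 6 * Real.pi ^ 2 + 2 * Real.pi

theorem cauchyConst_nonneg : 0 ≤ cauchyConst := by
  have := Real.pi_pos
  unfold cauchyConst
  positivity

theorem continuous_exp_div_sub_mul_I (x : ℤ) {η : ℝ} (hη : η ≠ 0) :
    Continuous fun v : ℝ => exp (I * x * v) / ((v : ℂ) - η * I) :=
  Continuous.div (by fun_prop) (by fun_prop) fun v => sub_mul_I_ne_zero v hη

theorem norm_integral_exp_div_pos_le (x : ℤ) {η : ℝ} (hη : 0 < η) :
    ‖∫ v in (-Real.pi)..Real.pi, exp (I * x * v) / ((v : ℂ) - η * I)‖ ≤ cauchyConst := by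
  have hpi := Real.pi_pos
  have hlen : |Real.pi - -Real.pi| = 2 * Real.pi := by rw [abs_of_pos] <;> linarith
  rcases le_or_gt η 1 with h1 | h1
  -- For `η ≤ 1` the geometric kernel is subtracted; for `η > 1` the integrand is already bounded by
  -- `1`.
  · have hc := norm_integral_exp_div_one_sub_le x (r := 1 - η) (by linarith) (by linarith)
    have hcont2 : ContinuousOn (fun v : ℝ => exp (I * x * v) / (1 - (1 - η : ℝ) * exp (-(I * v))))
        (Set.uIcc (-Real.pi) Real.pi) := by
      refine ContinuousOn.div (by fun_prop) (by fun_prop) fun v _ => ?_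
      intro h
      have : ‖((1 - η : ℝ) : ℂ) * exp (-(I * v))‖ = 1 := by rw [← sub_eq_zero.mp h, norm_one]
      rw [norm_mul, Complex.norm_exp, Complex.norm_real, Real.norm_of_nonneg (by linarith)] at this
      simp at this
      linarith
    have hi1 := (continuous_exp_div_sub_mul_I x hη.ne').intervalIntegrable
      (μ := volume) (-Real.pi) Real.pi
    have hi2 := hcont2.intervalIntegrable (μ := volume)
    have hsplit : ∫ v in (-Real.pi)..Real.pi, exp (I * x * v) / ((v : ℂ) - η * I)
        = (∫ v in (-Real.pi)..Real.pi, (exp (I * x * v) / ((v : ℂ) - η * I)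
          - I * (exp (I * x * v) / (1 - (1 - η : ℝ) * exp (-(I * v))))))
        + I * ∫ v in (-Real.pi)..Real.pi, exp (I * x * v) / (1 - (1 - η : ℝ) * exp (-(I * v))) := by
      rw [← intervalIntegral.integral_const_mul, ← intervalIntegral.integral_add]
      · simp
      · exact hi1.sub (hi2.const_mul I)
      · exact hi2.const_mul I
    rw [hsplit]
    refine (norm_add_le _ _).trans ?_
    have hb : ‖∫ v in (-Real.pi)..Real.pi, (exp (I * x * v) / ((v : ℂ) - η * I)
          - I * (exp (I * x * v) / (1 - (1 - η : ℝ) * exp (-(I * v)))))‖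
        ≤ 3 * Real.pi * |Real.pi - -Real.pi| := by
      refine intervalIntegral.norm_integral_le_of_norm_le_const fun v hv => ?_
      rw [Set.uIoc_of_le (by linarith)] at hv
      have : exp (I * x * v) / ((v : ℂ) - η * I)
          - I * (exp (I * x * v) / (1 - (1 - η : ℝ) * exp (-(I * v))))
          = exp (I * x * v) * (1 / ((v : ℂ) - η * I) - I / (1 - (1 - η : ℝ) * exp (-(I * v)))) := by
        ring
      rw [this, norm_mul, norm_exp_I_int_mul, one_mul]
      exact norm_cauchy_sub_geometric_le hη h1 (abs_le.mpr ⟨hv.1.le, hv.2⟩)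
    rw [norm_mul, Complex.norm_I, one_mul]
    rw [hlen] at hb
    unfold cauchyConst
    nlinarith
  · have hb : ‖∫ v in (-Real.pi)..Real.pi, exp (I * x * v) / ((v : ℂ) - η * I)‖
        ≤ 1 * |Real.pi - -Real.pi| := by
      refine intervalIntegral.norm_integral_le_of_norm_le_const fun v _ => ?_
      rw [norm_div, norm_exp_I_int_mul]
      have := abs_le_norm_sub_mul_I' v η
      rw [abs_of_pos hη] at this
      rw [div_le_one (by linarith)]
      linarith
    rw [hlen] at hb
    unfold cauchyConst
    nlinarith [sq_nonneg Real.pi]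

theorem norm_integral_exp_div_le (x : ℤ) {η : ℝ} (hη : η ≠ 0) :
    ‖∫ v in (-Real.pi)..Real.pi, exp (I * x * v) / ((v : ℂ) - η * I)‖ ≤ cauchyConst := by
  rcases lt_or_gt_of_ne hη with h | h
  · have h2 := norm_integral_exp_div_pos_le (-x) (neg_pos.mpr h)
    have h3 : ∫ v in (-Real.pi)..Real.pi, exp (I * x * v) / ((v : ℂ) - η * I)
        = -∫ v in (-Real.pi)..Real.pi, exp (I * (-x : ℤ) * v) / ((v : ℂ) - (-η : ℝ) * I) := by
      have := intervalIntegral.integral_comp_neg (a := -Real.pi) (b := Real.pi)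
        (fun v : ℝ => exp (I * x * v) / ((v : ℂ) - η * I))
      rw [neg_neg] at this
      rw [← this, ← intervalIntegral.integral_neg]
      refine intervalIntegral.integral_congr fun v _ => ?_
      push_cast
      rw [← div_neg]
      congr 1
      · congr 1; ring
      · ring
    rw [h3, norm_neg]
    exact h2
  · exact norm_integral_exp_div_pos_le x h

/-! ### Cauchy integrals with a curved phase on a short window -/

/-- Replacing the denominator costs a Taylor error `M v²` against a product of size at least `c²
v²`; replacing the amplitude costs `L|v|` against `c|v|`. Neither quotient depends on `ε`. The phase
is controlled only where `f₁ ≠ 0`, because outside the window nothing is known about it. -/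
theorem norm_div_sub_div_model_le {f₁ f₀ y e v c M A L ε : ℝ} (hc : 0 < c) (hM : 0 ≤ M)
    (hA : 0 ≤ A) (hL : 0 ≤ L) (hε : ε ≠ 0) (hce : c ≤ e) (hfA : |f₁| ≤ A)
    (hfL : |f₁ - f₀| ≤ L * |v|)
    (hy : f₁ ≠ 0 → c * |v| ≤ |y| ∧ |y - e * v| ≤ M * v ^ 2) :
    ‖(f₁ : ℂ) / ((y : ℂ) - ε * I) - (f₀ : ℂ) / (((e * v : ℝ) : ℂ) - ε * I)‖
      ≤ A * M / c ^ 2 + L / c := by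
  have h1 := sub_mul_I_ne_zero y hε
  have h2 := sub_mul_I_ne_zero (e * v) hε
  have n1 := abs_le_norm_sub_mul_I y ε
  have n2 := abs_le_norm_sub_mul_I (e * v) ε
  rw [abs_mul, abs_of_pos (hc.trans_le hce)] at n2
  set a₁ : ℂ := (y : ℂ) - ε * I with ha1
  set a₂ : ℂ := ((e * v : ℝ) : ℂ) - ε * I with ha2
  have p1 : 0 < ‖a₁‖ := norm_pos_iff.mpr h1
  have p2 : 0 < ‖a₂‖ := norm_pos_iff.mpr h2
  have n2' : c * |v| ≤ ‖a₂‖ := le_trans (by gcongr) n2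
  have heq : (f₁ : ℂ) / a₁ - (f₀ : ℂ) / a₂
      = -((f₁ * (y - e * v) : ℝ) : ℂ) / (a₁ * a₂) + ((f₁ - f₀ : ℝ) : ℂ) / a₂ := by
    field_simp
    rw [ha1, ha2]
    push_cast
    ring
  rw [heq]
  refine (norm_add_le _ _).trans (add_le_add ?_ ?_)
  · rw [norm_div, norm_neg, norm_mul, Complex.norm_real, Real.norm_eq_abs, abs_mul,
      div_le_iff₀ (by positivity)]
    by_cases hf : f₁ = 0
    · rw [hf, abs_zero, zero_mul]
      positivity
    · obtain ⟨hy1, hy2⟩ := hy hf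
      have : A * M / c ^ 2 * (‖a₁‖ * ‖a₂‖) ≥ A * M / c ^ 2 * ((c * |v|) * (c * |v|)) := by
        gcongr
        exact hy1.trans n1
      refine le_trans ?_ this
      have h3 : A * M / c ^ 2 * ((c * |v|) * (c * |v|)) = A * (M * v ^ 2) := by
        rw [← sq_abs v]
        field_simp
      rw [h3]
      gcongr
  · rw [norm_div, Complex.norm_real, Real.norm_eq_abs, div_le_iff₀ p2]
    refine hfL.trans ?_
    calc L * |v| = L / c * (c * |v|) := by field_simp
      _ ≤ L / c * ‖a₂‖ := by gcongr

/-- By the intermediate value theorem `μ` lies beyond the value of `E` at one end of the window, and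
`E` moves away from it with slope at least `c` from that end. A zero of `E - μ` just outside the
window is thus compensated by the vanishing of the tent. -/
theorem tent_le_abs_of_ne {E : ℝ → ℝ} {s δ c μ : ℝ} (hδ : 0 < δ) (hc : 0 < c)
    (hE : Continuous E)
    (hmono : ∀ t ∈ Set.Icc (s - δ) (s + δ), ∀ t' ∈ Set.Icc (s - δ) (s + δ), t ≤ t' →
      c * (t' - t) ≤ E t' - E t)
    (hne : ∀ t ∈ Set.Icc (s - δ) (s + δ), E t ≠ μ) (t : ℝ) :
    c * max 0 (δ - |t - s|) ≤ |E t - μ| := by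
  rcases le_or_gt (δ - |t - s|) 0 with h | h
  · rw [max_eq_left h, mul_zero]
    exact abs_nonneg _
  rw [max_eq_right h.le]
  obtain ⟨h1, h2⟩ := abs_lt.mp (sub_pos.mp h)
  have hl : s - δ ∈ Set.Icc (s - δ) (s + δ) := ⟨le_rfl, by linarith⟩
  have hr : s + δ ∈ Set.Icc (s - δ) (s + δ) := ⟨by linarith, le_rfl⟩
  have ht : t ∈ Set.Icc (s - δ) (s + δ) := ⟨by linarith, by linarith⟩
  have m1 := hmono _ hl _ ht ht.1
  have m2 := hmono _ ht _ hr ht.2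
  have key : μ < E (s - δ) ∨ E (s + δ) < μ := by
    by_contra hcon
    push Not at hcon
    obtain ⟨k, hk, hk'⟩ := intermediate_value_Icc (by linarith : s - δ ≤ s + δ)
      hE.continuousOn ⟨hcon.1, hcon.2⟩
    exact hne k hk hk'
  have b1 := neg_abs_le (t - s)
  have b2 := le_abs_self (t - s)
  rcases key with hk | hk
  · refine le_trans ?_ (le_abs_self _)
    nlinarith
  · refine le_trans ?_ (neg_le_abs _)
    nlinarith

/-- Either `E` misses `μ` on the window, and the tent factor makes the integrand bounded, or `E`
takes the value `μ` at some `k`, and the integrand is compared with its linearization at `k`. The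
stated constant is the sum of the bounds for the two cases. -/
theorem norm_integral_local_le {E f : ℝ → ℝ} {s δ c M A L μ ε : ℝ} (hδ : 0 < δ) (hδ1 : δ ≤ 1)
    (hc : 0 < c) (hM : 0 ≤ M) (hA : 0 ≤ A) (hL : 0 ≤ L) (hε : ε ≠ 0)
    (hE : Continuous E) (hf : Continuous f)
    (hmono : ∀ t ∈ Set.Icc (s - δ) (s + δ), ∀ t' ∈ Set.Icc (s - δ) (s + δ), t ≤ t' →
      c * (t' - t) ≤ E t' - E t)
    (htaylor : ∀ t₀ ∈ Set.Icc (s - δ) (s + δ), ∃ e, c ≤ e ∧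
      ∀ t ∈ Set.Icc (s - δ) (s + δ), |E t - E t₀ - e * (t - t₀)| ≤ M * (t - t₀) ^ 2)
    (hfA : ∀ t, |f t| ≤ A * max 0 (δ - |t - s|)) (hfL : ∀ t t', |f t - f t'| ≤ L * |t - t'|)
    (x : ℤ) :
    ‖∫ t in (s - δ)..(s + δ), f t * exp (I * x * t) / (((E t - μ : ℝ) : ℂ) - ε * I)‖
      ≤ 2 * A / c + 2 * Real.pi * (A * M / c ^ 2 + L / c) + A * cauchyConst / c := by
  have hpi := Real.pi_gt_three
  have hC := cauchyConst_nonneg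
  by_cases hne : ∀ t ∈ Set.Icc (s - δ) (s + δ), E t ≠ μ
  · have hb : ‖∫ t in (s - δ)..(s + δ), f t * exp (I * x * t) / (((E t - μ : ℝ) : ℂ) - ε * I)‖
        ≤ A / c * |s + δ - (s - δ)| := by
      refine intervalIntegral.norm_integral_le_of_norm_le_const fun t _ => ?_
      have h1 := tent_le_abs_of_ne hδ hc hE hmono hne t
      have h2 := abs_le_norm_sub_mul_I (E t - μ) ε
      rw [norm_div, norm_mul, norm_exp_I_int_mul, mul_one, Complex.norm_real, Real.norm_eq_abs,
        div_le_iff₀ (norm_pos_iff.mpr (sub_mul_I_ne_zero _ hε))]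
      calc |f t| ≤ A * max 0 (δ - |t - s|) := hfA t
        _ = A / c * (c * max 0 (δ - |t - s|)) := by field_simp
        _ ≤ A / c * ‖((E t - μ : ℝ) : ℂ) - ε * I‖ := by gcongr; exact h1.trans h2
    have hlen : |s + δ - (s - δ)| = 2 * δ := by rw [abs_of_pos] <;> linarith
    rw [hlen] at hb
    have h3 : A / c * (2 * δ) ≤ 2 * A / c := by
      have : A / c * (2 * δ) = (2 * A / c) * δ := by ring
      rw [this]
      exact mul_le_of_le_one_right (by positivity) hδ1
    have h4 : 0 ≤ 2 * Real.pi * (A * M / c ^ 2 + L / c) := by positivity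
    have h5 : 0 ≤ A * cauchyConst / c := by positivity
    linarith
  push Not at hne
  obtain ⟨k, hk, hkμ⟩ := hne
  obtain ⟨e, hce, htay⟩ := htaylor k hk
  have he : 0 < e := hc.trans_le hce
  set F : ℝ → ℂ := fun t => f t * exp (I * x * t) / (((E t - μ : ℝ) : ℂ) - ε * I) with hF
  have hFc : Continuous F := by
    refine Continuous.div (by fun_prop) (by fun_prop) fun t => sub_mul_I_ne_zero _ hε
  have hf0 : ∀ t, f t ≠ 0 → t ∈ Set.Ioo (s - δ) (s + δ) := by
    intro t ht
    by_contra hcon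
    apply ht
    have : δ - |t - s| ≤ 0 := by
      by_contra h
      push Not at h
      obtain ⟨h1, h2⟩ := abs_lt.mp (sub_pos.mp h)
      exact hcon ⟨by linarith, by linarith⟩
    have h2 := hfA t
    rw [max_eq_left this, mul_zero] at h2
    exact abs_nonpos_iff.mp h2
  have hsupp : Function.support F ⊆ Set.Ioo (s - δ) (s + δ) := by
    intro t ht
    apply hf0
    intro h
    apply ht
    simp [hF, h]
  -- The support lies within distance `2δ ≤ 2 < π` of `k`, so the integral can be recentred at the
  -- zero and taken over a full symmetric period, as the model bound requires.
  have hshift : ∫ t in (s - δ)..(s + δ), F t = ∫ v in (-Real.pi)..Real.pi, F (v + k) := by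
    rw [intervalIntegral.integral_comp_add_right,
      intervalIntegral.integral_eq_integral_of_support_subset (hsupp.trans Set.Ioo_subset_Ioc_self),
      intervalIntegral.integral_eq_integral_of_support_subset]
    intro t ht
    have := hsupp ht
    exact ⟨by linarith [this.1, hk.2], by linarith [this.2, hk.1]⟩
  -- From `e v - iε = e (v - iη)`: the slope rescales the imaginary part and leaves the factor `1 /
  -- e` in `κ`.
  set η := ε / e with hη
  have hη0 : η ≠ 0 := div_ne_zero hε he.ne'
  set κ : ℂ := f k * exp (I * x * k) / e with hκ
  set G : ℝ → ℂ := fun v => exp (I * x * v) / ((v : ℂ) - η * I) with hG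
  have hGc : Continuous G := continuous_exp_div_sub_mul_I x hη0
  have hfA' : ∀ t, |f t| ≤ A := by
    intro t
    refine (hfA t).trans (mul_le_of_le_one_right hA ?_)
    have := abs_nonneg (t - s)
    exact max_le zero_le_one (by linarith)
  have hpt : ∀ v, ‖F (v + k) - κ * G v‖ ≤ A * M / c ^ 2 + L / c := by
    intro v
    have heC : (e : ℂ) ≠ 0 := by exact_mod_cast he.ne'
    have heq : F (v + k) - κ * G v = exp (I * x * (v + k : ℝ)) *
        ((f (v + k) : ℂ) / (((E (v + k) - μ : ℝ) : ℂ) - ε * I)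
          - (f k : ℂ) / (((e * v : ℝ) : ℂ) - ε * I)) := by
      have h1 : ((e * v : ℝ) : ℂ) - ε * I = e * ((v : ℂ) - η * I) := by
        rw [hη]
        push_cast
        field_simp
      have h2 : exp (I * x * (v + k : ℝ)) = exp (I * x * k) * exp (I * x * v) := by
        rw [← Complex.exp_add]
        congr 1
        push_cast
        ring
      simp only [hF, hG, hκ]
      rw [h1, h2]
      field_simp [sub_mul_I_ne_zero v hη0, sub_mul_I_ne_zero (E (v + k) - μ) hε]
    rw [heq, norm_mul, norm_exp_I_int_mul, one_mul]
    refine norm_div_sub_div_model_le hc hM hA hL hε hce (hfA' _) ?_ fun hfne => ?_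
    · have := hfL (v + k) k
      rwa [add_sub_cancel_right] at this
    · have ht := Set.Ioo_subset_Icc_self (hf0 _ hfne)
      have h1 := htay _ ht
      rw [hkμ, add_sub_cancel_right] at h1
      refine ⟨?_, h1⟩
      rw [← hkμ]
      rcases le_total 0 v with hv | hv
      · have := hmono k hk _ ht (by linarith)
        rw [abs_of_nonneg hv]
        refine le_trans ?_ (le_abs_self _)
        linarith
      · have := hmono _ ht k hk (by linarith)
        rw [abs_of_nonpos hv]
        refine le_trans ?_ (neg_le_abs _)
        linarith
  have hi1 : IntervalIntegrable (fun v => F (v + k)) volume (-Real.pi) Real.pi :=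
    (hFc.comp (continuous_add_const k)).intervalIntegrable _ _
  have hi2 : IntervalIntegrable (fun v => κ * G v) volume (-Real.pi) Real.pi :=
    (continuous_const.mul hGc).intervalIntegrable _ _
  have hsplit : ∫ v in (-Real.pi)..Real.pi, F (v + k)
      = (∫ v in (-Real.pi)..Real.pi, (F (v + k) - κ * G v)) + κ * ∫ v in (-Real.pi)..Real.pi, G v := by
    rw [← intervalIntegral.integral_const_mul, ← intervalIntegral.integral_add (hi1.sub hi2) hi2]
    simp
  have hlen : |Real.pi - -Real.pi| = 2 * Real.pi := by rw [abs_of_pos] <;> linarith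
  have hb := intervalIntegral.norm_integral_le_of_norm_le_const (a := -Real.pi) (b := Real.pi)
    fun v _ => hpt v
  rw [hlen] at hb
  have hκn : ‖κ‖ ≤ A / c := by
    rw [hκ, norm_div, norm_mul, norm_exp_I_int_mul, mul_one, Complex.norm_real, Complex.norm_real,
      Real.norm_eq_abs, Real.norm_of_nonneg he.le]
    exact div_le_div₀ hA (hfA' k) hc hce
  have hb2 : ‖κ * ∫ v in (-Real.pi)..Real.pi, G v‖ ≤ A * cauchyConst / c := by
    rw [norm_mul, mul_div_right_comm]
    exact mul_le_mul hκn (norm_integral_exp_div_le x hη0) (norm_nonneg _) (by positivity)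
  rw [hshift, hsplit]
  refine (norm_add_le _ _).trans ?_
  have h4 : 0 ≤ 2 * A / c := by positivity
  linarith

/-! ### From short windows to a full period -/

theorem intervalIntegral_swap_of_continuousOn {f : ℝ → ℝ → ℂ} {a b c d : ℝ} (hab : a ≤ b)
    (hcd : c ≤ d) (hf : ContinuousOn (Function.uncurry f) (Set.Icc a b ×ˢ Set.Icc c d)) :
    ∫ x in a..b, ∫ y in c..d, f x y = ∫ y in c..d, ∫ x in a..b, f x y := by
  simp only [intervalIntegral.integral_of_le hcd]
  refine MeasureTheory.intervalIntegral_integral_swap ?_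
  rw [Set.uIoc_of_le hab, Measure.prod_restrict]
  have h := hf.integrableOn_compact (μ := (volume : Measure ℝ).prod volume)
    (isCompact_Icc.prod isCompact_Icc)
  exact h.mono_set (Set.prod_mono Set.Ioc_subset_Icc_self Set.Ioc_subset_Icc_self)

theorem ofReal_sub_ne_zero (y : ℝ) {z : ℂ} (hz : z.im ≠ 0) : (y : ℂ) - z ≠ 0 := by
  intro h
  have := congrArg Complex.im h
  simp at this
  exact hz this

theorem exists_slope_eq {E E' : ℝ → ℝ} (hE : ∀ t, HasDerivAt E (E' t) t) (t₀ t : ℝ) :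
    ∃ ξ, |ξ - t₀| ≤ |t - t₀| ∧ ξ ∈ Set.uIcc t₀ t ∧ E t - E t₀ = E' ξ * (t - t₀) := by
  rcases lt_trichotomy t₀ t with h | h | h
  · obtain ⟨ξ, hξ, h2⟩ := exists_hasDerivAt_eq_slope E E' h
      (fun t _ => (hE t).continuousAt.continuousWithinAt) fun t _ => hE t
    refine ⟨ξ, ?_, ?_, ?_⟩
    · rw [abs_of_pos (sub_pos.mpr hξ.1), abs_of_pos (sub_pos.mpr h)]
      linarith [hξ.2]
    · rw [Set.uIcc_of_le h.le]
      exact ⟨hξ.1.le, hξ.2.le⟩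
    · rw [h2, div_mul_cancel₀ _ (sub_pos.mpr h).ne']
  · exact ⟨t₀, by simp, by simp, by simp [h]⟩
  · obtain ⟨ξ, hξ, h2⟩ := exists_hasDerivAt_eq_slope E E' h
      (fun t _ => (hE t).continuousAt.continuousWithinAt) fun t _ => hE t
    refine ⟨ξ, ?_, ?_, ?_⟩
    · rw [abs_of_neg (sub_neg.mpr hξ.2), abs_of_neg (sub_neg.mpr h)]
      linarith [hξ.1]
    · rw [Set.uIcc_of_ge h.le]
      exact ⟨hξ.1.le, hξ.2.le⟩
    · have := div_mul_cancel₀ (E t₀ - E t) (sub_pos.mpr h).ne'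
      rw [h2]
      linarith

/-- The tent of height and half-width `δ` centred at `0`. -/
def tent (δ u : ℝ) : ℝ := max 0 (δ - |u|)

theorem continuous_tent (δ : ℝ) : Continuous (tent δ) := by
  unfold tent
  fun_prop

theorem tent_nonneg (δ u : ℝ) : 0 ≤ tent δ u := le_max_left _ _

theorem tent_le {δ : ℝ} (hδ : 0 ≤ δ) (u : ℝ) : tent δ u ≤ δ :=
  max_le hδ (by linarith [abs_nonneg u])

theorem abs_tent_sub_le (δ u v : ℝ) : |tent δ u - tent δ v| ≤ |u - v| := by
  unfold tent
  refine (abs_max_sub_max_le_max _ _ _ _).trans (max_le (by simp) ?_)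
  rw [sub_sub_sub_cancel_left, abs_sub_comm u v]
  exact abs_abs_sub_abs_le _ _

/-- The bound for the Cauchy integral localized by a tent. -/
noncomputable def tentConst (c M A L : ℝ) : ℝ :=
  2 * A / (c / 2) + 2 * Real.pi * (A * M / (c / 2) ^ 2 + (A + L) / (c / 2))
    + A * cauchyConst / (c / 2)

theorem tentConst_nonneg {c M A L : ℝ} (hc : 0 < c) (hM : 0 ≤ M) (hA : 0 ≤ A) (hL : 0 ≤ L) :
    0 ≤ tentConst c M A L := by
  have := cauchyConst_nonneg
  have := Real.pi_pos
  unfold tentConst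
  positivity

/-- The window is so short that slope `c` at one point forces slope `c / 2` throughout. The tent is
`1`-Lipschitz and at most `1`, so the localized amplitude has Lipschitz constant `A + L`. -/
theorem norm_integral_tent_pos_le {c M A L δ : ℝ} (hc : 0 < c) (hM : 0 ≤ M) (hA : 0 ≤ A)
    (hL : 0 ≤ L) (hδ : 0 < δ) (hδ1 : δ ≤ 1) (hδM : M * (2 * δ) ≤ c / 2) {E E' a : ℝ → ℝ}
    (hE : ∀ t, HasDerivAt E (E' t) t) (hE' : ∀ t t', |E' t - E' t'| ≤ M * |t - t'|)
    (haA : ∀ t, |a t| ≤ A) (haL : ∀ t t', |a t - a t'| ≤ L * |t - t'|) {s t₁ : ℝ}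
    (ht₁ : t₁ ∈ Set.Icc (s - δ) (s + δ)) (hct : c ≤ E' t₁) (x : ℤ) {z : ℂ} (hz : z.im ≠ 0) :
    ‖∫ t in (s - δ)..(s + δ), (tent δ (t - s) : ℂ) * (a t * exp (I * x * t) / (E t - z))‖
      ≤ tentConst c M A L := by
  have hder : ∀ t ∈ Set.Icc (s - δ) (s + δ), c / 2 ≤ E' t := by
    intro t ht
    have h1 := hE' t₁ t
    have h2 : |t₁ - t| ≤ 2 * δ := by
      rw [abs_le]
      constructor <;> linarith [ht.1, ht.2, ht₁.1, ht₁.2]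
    have h3 : M * |t₁ - t| ≤ M * (2 * δ) := by gcongr
    have := le_abs_self (E' t₁ - E' t)
    linarith
  have hLip : ∀ t t', |a t * tent δ (t - s) - a t' * tent δ (t' - s)| ≤ (A + L) * |t - t'| := by
    intro t t'
    have h1 : a t * tent δ (t - s) - a t' * tent δ (t' - s)
        = a t * (tent δ (t - s) - tent δ (t' - s)) + (a t - a t') * tent δ (t' - s) := by ring
    rw [h1]
    refine (abs_add_le _ _).trans ?_
    rw [abs_mul, abs_mul, abs_of_nonneg (tent_nonneg δ (t' - s)), add_mul]
    have h2 := abs_tent_sub_le δ (t - s) (t' - s)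
    rw [sub_sub_sub_cancel_right] at h2
    refine add_le_add (mul_le_mul (haA t) h2 (abs_nonneg _) hA) ?_
    calc |a t - a t'| * tent δ (t' - s) ≤ (L * |t - t'|) * 1 :=
          mul_le_mul (haL t t') ((tent_le hδ.le _).trans hδ1) (tent_nonneg _ _) (by positivity)
      _ = L * |t - t'| := mul_one _
  have hac : Continuous a := (LipschitzWith.of_dist_le_mul (K := ⟨L, hL⟩) haL).continuous
  have hEc : Continuous E := continuous_iff_continuousAt.mpr fun t => (hE t).continuousAt
  have h := norm_integral_local_le (E := E) (f := fun t => a t * tent δ (t - s)) (s := s) (δ := δ)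
    (c := c / 2) (M := M) (A := A) (L := A + L) (μ := z.re) (ε := z.im) hδ hδ1 (by positivity)
    hM hA (by positivity) hz hEc
    (hac.mul ((continuous_tent δ).comp (by fun_prop))) ?_ ?_ ?_ hLip x
  · refine le_of_eq_of_le ?_ h
    congr 1
    refine intervalIntegral.integral_congr fun t _ => ?_
    have h2 : ((E t - z.re : ℝ) : ℂ) - z.im * I = E t - z := by
      conv_rhs => rw [← Complex.re_add_im z]
      push_cast
      ring
    simp only [h2]
    push_cast
    ring
  · intro t ht t' ht' hle
    obtain ⟨ξ, -, h1, h2⟩ := exists_slope_eq hE t t'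
    rw [h2]
    have := hder ξ (Set.uIcc_subset_Icc ht ht' h1)
    gcongr
  · intro t₀ ht₀
    refine ⟨E' t₀, hder _ ht₀, fun t ht => ?_⟩
    obtain ⟨ξ, h1, -, h2⟩ := exists_slope_eq hE t₀ t
    rw [h2, ← sub_mul, abs_mul, ← sq_abs (t - t₀), sq, ← mul_assoc]
    gcongr
    exact (hE' _ _).trans (by gcongr)
  · intro t
    change |a t * tent δ (t - s)| ≤ A * tent δ (t - s)
    rw [abs_mul, abs_of_nonneg (tent_nonneg _ _)]
    exact mul_le_mul_of_nonneg_right (haA t) (tent_nonneg _ _)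

theorem norm_integral_tent_le {c M A L δ : ℝ} (hc : 0 < c) (hM : 0 ≤ M) (hA : 0 ≤ A)
    (hL : 0 ≤ L) (hδ : 0 < δ) (hδ1 : δ ≤ 1) (hδM : M * (2 * δ) ≤ c / 2) {E E' a : ℝ → ℝ}
    (hE : ∀ t, HasDerivAt E (E' t) t) (hE' : ∀ t t', |E' t - E' t'| ≤ M * |t - t'|)
    (haA : ∀ t, |a t| ≤ A) (haL : ∀ t t', |a t - a t'| ≤ L * |t - t'|)
    (hac : ∀ t, a t ≠ 0 → c ≤ |E' t|) (s : ℝ) (x : ℤ) {z : ℂ} (hz : z.im ≠ 0) :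
    ‖∫ t in (s - δ)..(s + δ), (tent δ (t - s) : ℂ) * (a t * exp (I * x * t) / (E t - z))‖
      ≤ tentConst c M A L := by
  by_cases h0 : ∀ t ∈ Set.Icc (s - δ) (s + δ), a t = 0
  · rw [intervalIntegral.integral_zero_ae]
    · rw [norm_zero]
      exact tentConst_nonneg hc hM hA hL
    · refine Filter.Eventually.of_forall fun t ht => ?_
      rw [Set.uIoc_of_le (by linarith)] at ht
      simp [h0 t (Set.Ioc_subset_Icc_self ht)]
  push Not at h0
  obtain ⟨t₁, ht₁, ha⟩ := h0
  rcases le_total 0 (E' t₁) with hs | hs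
  · have := hac t₁ ha
    rw [abs_of_nonneg hs] at this
    exact norm_integral_tent_pos_le hc hM hA hL hδ hδ1 hδM hE hE' haA haL ht₁ this x hz
  · have h1 := hac t₁ ha
    rw [abs_of_nonpos hs] at h1
    -- A decreasing phase is reduced to an increasing one by changing the signs of both `E` and `z`,
    -- which only flips the sign of the integral.
    have := norm_integral_tent_pos_le (E := fun t => -E t) (E' := fun t => -E' t) (z := -z)
      hc hM hA hL hδ hδ1 hδM (fun t => (hE t).neg)
      (fun t t' => by rw [neg_sub_neg, abs_sub_comm]; exact hE' t t') haA haL ht₁ h1 x (by simpa)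
    refine le_of_eq_of_le ?_ this
    rw [← norm_neg, ← intervalIntegral.integral_neg]
    congr 1
    refine intervalIntegral.integral_congr fun t _ => ?_
    simp only [Complex.ofReal_neg, neg_sub_neg]
    rw [← neg_sub (E t : ℂ) z, div_neg, mul_neg]

/-- Integrating the local bound over all tent centres `s` in one period reproduces the full integral
times `B = ∫ tent`, by Fubini and periodicity; no partition adapted to `E` is needed. Hence `C`
depends only on `c, M, A, L`, which allows it to serve for every coordinate line at once. -/
theorem exists_norm_integral_cauchy_le {c M A L : ℝ} (hc : 0 < c) (hM : 0 ≤ M) (hA : 0 ≤ A)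
    (hL : 0 ≤ L) :
    ∃ C, 0 ≤ C ∧ ∀ E E' a : ℝ → ℝ, (∀ t, HasDerivAt E (E' t) t) →
      (∀ t t', |E' t - E' t'| ≤ M * |t - t'|) → (∀ t, |a t| ≤ A) →
      (∀ t t', |a t - a t'| ≤ L * |t - t'|) → (∀ t, a t ≠ 0 → c ≤ |E' t|) →
      Function.Periodic E (2 * Real.pi) → Function.Periodic a (2 * Real.pi) →
      ∀ (x : ℤ) (z : ℂ), z.im ≠ 0 →
        ‖∫ t in (0 : ℝ)..(2 * Real.pi), a t * exp (I * x * t) / (E t - z)‖ ≤ C := by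
  have hpi := Real.pi_pos
  -- This ensures `2 M δ ≤ c / 2`; the `+ 1` covers `M = 0`.
  set δ := min 1 (c / (4 * (M + 1))) with hδdef
  have hδ : 0 < δ := lt_min one_pos (by positivity)
  have hδ1 : δ ≤ 1 := min_le_left _ _
  have hδM : M * (2 * δ) ≤ c / 2 := by
    have h1 : δ ≤ c / (4 * (M + 1)) := min_le_right _ _
    rw [le_div_iff₀ (by positivity)] at h1
    nlinarith
  set B := ∫ u in (-δ)..δ, tent δ u with hB
  have hBpos : 0 < B := by
    refine intervalIntegral.intervalIntegral_pos_of_pos_on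
      ((continuous_tent δ).intervalIntegrable _ _) (fun u hu => ?_) (by linarith)
    exact lt_max_of_lt_right (sub_pos.mpr (abs_lt.mpr hu))
  have hK := tentConst_nonneg hc hM hA hL
  refine ⟨2 * Real.pi * tentConst c M A L / B, by positivity, ?_⟩
  intro E E' a hE hE' haA haL hac hEper haper x z hz
  have hacont : Continuous a := (LipschitzWith.of_dist_le_mul (K := ⟨L, hL⟩) haL).continuous
  have hEc : Continuous E := continuous_iff_continuousAt.mpr fun t => (hE t).continuousAt
  set h : ℝ → ℂ := fun t => a t * exp (I * x * t) / (E t - z) with hh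
  have hcont : Continuous h :=
    Continuous.div (by fun_prop) (by fun_prop) fun t => ofReal_sub_ne_zero _ hz
  have hper : Function.Periodic h (2 * Real.pi) := by
    intro t
    have : exp (I * x * (t + 2 * Real.pi : ℝ)) = exp (I * x * t) := by
      rw [← (Complex.exp_periodic.int_mul x) (I * x * t)]
      congr 1
      push_cast
      ring
    simp only [hh, hEper t, haper t, this]
  have hloc : ∀ s, ‖∫ u in (-δ)..δ, (tent δ u : ℂ) * h (s + u)‖ ≤ tentConst c M A L := by
    intro s
    have := norm_integral_tent_le hc hM hA hL hδ hδ1 hδM hE hE' haA haL hac s x hz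
    refine le_of_eq_of_le ?_ this
    have h2 := intervalIntegral.integral_comp_add_left (a := -δ) (b := δ)
      (fun t => (tent δ (t - s) : ℂ) * h t) s
    simp only [add_sub_cancel_left] at h2
    rw [h2, ← sub_eq_add_neg]
  have hswap : ∫ s in (0 : ℝ)..(2 * Real.pi), ∫ u in (-δ)..δ, (tent δ u : ℂ) * h (s + u)
      = (B : ℂ) * ∫ t in (0 : ℝ)..(2 * Real.pi), h t := by
    rw [intervalIntegral_swap_of_continuousOn (by positivity) (by linarith)]
    · have : ∀ u, ∫ s in (0 : ℝ)..(2 * Real.pi), (tent δ u : ℂ) * h (s + u)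
          = (tent δ u : ℂ) * ∫ t in (0 : ℝ)..(2 * Real.pi), h t := by
        intro u
        rw [intervalIntegral.integral_const_mul, intervalIntegral.integral_comp_add_right]
        have := hper.intervalIntegral_add_eq u 0
        rw [zero_add] at this
        rw [zero_add, add_comm (2 * Real.pi) u, this]
      simp only [this]
      rw [intervalIntegral.integral_mul_const, intervalIntegral.integral_ofReal]
    · have := continuous_tent δ
      exact Continuous.continuousOn (by fun_prop)
  have hb := intervalIntegral.norm_integral_le_of_norm_le_const (a := 0) (b := 2 * Real.pi)
    fun s _ => hloc s
  rw [hswap, norm_mul, Complex.norm_real, Real.norm_of_nonneg hBpos.le, sub_zero,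
    abs_of_pos (by positivity)] at hb
  rw [le_div_iff₀ hBpos]
  linarith

/-! ### Dependence of the Cauchy integral on the spectral parameter -/

/-- The difference is the integral of the `z`-derivative along the segment from `z'` to `z`. The
factor `E'` in the amplitude makes the double pole an exact derivative, and integration by parts
leaves simple-pole integrals with amplitudes `g'` and `x g`, both uniformly bounded. -/
theorem exists_norm_integral_cauchy_sub_le {c M A L : ℝ} (hc : 0 < c) (hM : 0 ≤ M) (hA : 0 ≤ A)
    (hL : 0 ≤ L) :
    ∃ C, 0 ≤ C ∧ ∀ E E' g g' : ℝ → ℝ, (∀ t, HasDerivAt E (E' t) t) →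
      (∀ t t', |E' t - E' t'| ≤ M * |t - t'|) → (∀ t, HasDerivAt g (g' t) t) →
      (∀ t, |g t| ≤ A) → (∀ t t', |g t - g t'| ≤ L * |t - t'|) →
      (∀ t, |g' t| ≤ A) → (∀ t t', |g' t - g' t'| ≤ L * |t - t'|) →
      (∀ t, g t ≠ 0 → c ≤ |E' t|) →
      Function.Periodic E (2 * Real.pi) → Function.Periodic g (2 * Real.pi) →
      Function.Periodic g' (2 * Real.pi) →
      ∀ (x : ℤ) (z z' : ℂ), 0 < z.im * z'.im →
        ‖(∫ t in (0 : ℝ)..(2 * Real.pi), ((g t * E' t : ℝ) : ℂ) * exp (I * x * t) / (E t - z))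
          - ∫ t in (0 : ℝ)..(2 * Real.pi), ((g t * E' t : ℝ) : ℂ) * exp (I * x * t) / (E t - z')‖
          ≤ C * (1 + |(x : ℝ)|) * ‖z - z'‖ := by
  have hpi := Real.pi_pos
  obtain ⟨C, hC, hbound⟩ := exists_norm_integral_cauchy_le hc hM hA hL
  refine ⟨C, hC, ?_⟩
  intro E E' g g' hE hE' hg hgA hgL hg'A hg'L hgc hEper hgper hg'per x z z' hzz
  have hgcont : Continuous g := continuous_iff_continuousAt.mpr fun t => (hg t).continuousAt
  have hg'cont : Continuous g' := (LipschitzWith.of_dist_le_mul (K := ⟨L, hL⟩) hg'L).continuous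
  have hE'cont : Continuous E' := (LipschitzWith.of_dist_le_mul (K := ⟨M, hM⟩) hE').continuous
  have hEc : Continuous E := continuous_iff_continuousAt.mpr fun t => (hE t).continuousAt
  -- The set `|E'| < c` is open and `g` vanishes on it, hence so does `g'`.
  have hg'c : ∀ t, g' t ≠ 0 → c ≤ |E' t| := by
    intro t ht
    by_contra hlt
    push Not at hlt
    apply ht
    have hev : ∀ᶠ y in nhds t, |E' y| < c := hE'cont.abs.continuousAt.eventually_lt_const hlt
    have hz : g =ᶠ[nhds t] fun _ => 0 := by
      filter_upwards [hev] with y hy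
      by_contra h
      exact absurd (hgc y h) (not_le.mpr hy)
    exact (hg t).unique ((hasDerivAt_const t (0 : ℝ)).congr_of_eventuallyEq hz)
  have hz : z.im ≠ 0 := by rintro h; simp [h] at hzz
  have hz' : z'.im ≠ 0 := by rintro h; simp [h] at hzz
  set w : ℝ → ℂ := fun τ => z' + τ * (z - z') with hw
  have hwim : ∀ τ ∈ Set.Icc (0 : ℝ) 1, (w τ).im ≠ 0 := by
    intro τ hτ
    have him : (w τ).im = (1 - τ) * z'.im + τ * z.im := by
      simp [hw]
      ring
    rw [him]
    intro h0
    -- Multiplying by `z'.im` treats both half planes together: this is a convex combination of two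
    -- positive numbers.
    have h2 : (1 - τ) * z'.im ^ 2 + τ * (z.im * z'.im) = 0 := by
      linear_combination z'.im * h0
    have p1 : 0 < z'.im ^ 2 := by positivity
    rcases eq_or_lt_of_le hτ.1 with h | h
    · rw [← h] at h2
      simp at h2
      exact hz' h2
    · nlinarith [mul_pos h hzz, mul_nonneg (sub_nonneg.mpr hτ.2) p1.le]
  set e : ℝ → ℂ := fun t => exp (I * x * t) with he
  have hec : Continuous e := by fun_prop
  have hper : ∀ t, e (t + 2 * Real.pi) = e t := by
    intro t
    simp only [he]
    rw [← (Complex.exp_periodic.int_mul x) (I * x * t)]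
    congr 1
    push_cast
    ring
  -- the derivative in the spectral parameter, integrated by parts
  have hder : ∀ τ ∈ Set.Icc (0 : ℝ) 1,
      ‖∫ t in (0 : ℝ)..(2 * Real.pi), ((g t * E' t : ℝ) : ℂ) * e t / (E t - w τ) ^ 2‖
        ≤ C * (1 + |(x : ℝ)|) := by
    intro τ hτ
    have hne : ∀ t, (E t : ℂ) - w τ ≠ 0 := fun t => ofReal_sub_ne_zero _ (hwim τ hτ)
    have hd : ∀ t, HasDerivAt (fun t => (g t : ℂ) * e t / (E t - w τ))
        (g' t * e t / (E t - w τ) + (I * x) * (g t * e t / (E t - w τ))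
          - ((g t * E' t : ℝ) : ℂ) * e t / (E t - w τ) ^ 2) t := by
      intro t
      have h1 : HasDerivAt e (I * x * e t) t := by
        have := (((hasDerivAt_id (t : ℂ)).const_mul (I * x)).cexp).comp_ofReal
        simp only [id, mul_one] at this
        rw [mul_comm]
        exact this
      have h2 := ((hg t).ofReal_comp.mul h1).div ((hE t).ofReal_comp.sub_const (w τ)) (hne t)
      refine h2.congr_deriv ?_
      have := hne t
      rw [Pi.mul_apply]
      push_cast
      field_simp
    have c1 : Continuous fun t => (g' t : ℂ) * e t / (E t - w τ) :=
      Continuous.div (by fun_prop) (by fun_prop) hne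
    have c2 : Continuous fun t => (I * x) * ((g t : ℂ) * e t / (E t - w τ)) :=
      continuous_const.mul (Continuous.div (by fun_prop) (by fun_prop) hne)
    have c3 : Continuous fun t => ((g t * E' t : ℝ) : ℂ) * e t / (E t - w τ) ^ 2 :=
      Continuous.div (by fun_prop) (by fun_prop) fun t => pow_ne_zero 2 (hne t)
    have c12 : Continuous fun t => (g' t : ℂ) * e t / (E t - w τ)
        + (I * x) * ((g t : ℂ) * e t / (E t - w τ)) := c1.add c2
    have hftc := intervalIntegral.integral_eq_sub_of_hasDerivAt (a := 0) (b := 2 * Real.pi)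
      (fun t _ => hd t) ((c12.sub c3).intervalIntegrable _ _)
    have hends : (g (2 * Real.pi) : ℂ) * e (2 * Real.pi) / (E (2 * Real.pi) - w τ)
        - (g 0 : ℂ) * e 0 / (E 0 - w τ) = 0 := by
      have h1 := hper 0
      have h2 := hgper 0
      have h3 := hEper 0
      rw [zero_add] at h1 h2 h3
      rw [h1, h2, h3, sub_self]
    rw [hends, intervalIntegral.integral_sub (c12.intervalIntegrable _ _)
      (c3.intervalIntegrable _ _), intervalIntegral.integral_add (c1.intervalIntegrable _ _)
      (c2.intervalIntegrable _ _), intervalIntegral.integral_const_mul, sub_eq_zero] at hftc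
    rw [← hftc]
    refine (norm_add_le _ _).trans ?_
    have b1 := hbound E E' g' hE hE' hg'A hg'L hg'c hEper hg'per x (w τ) (hwim τ hτ)
    have b2 := hbound E E' g hE hE' hgA hgL hgc hEper hgper x (w τ) (hwim τ hτ)
    rw [norm_mul, norm_mul, Complex.norm_I, one_mul, Complex.norm_intCast, mul_add, mul_one,
      mul_comm C]
    exact add_le_add b1 (mul_le_mul_of_nonneg_left b2 (abs_nonneg _))
  have hdiff : (∫ t in (0 : ℝ)..(2 * Real.pi), ((g t * E' t : ℝ) : ℂ) * e t / (E t - z))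
      - (∫ t in (0 : ℝ)..(2 * Real.pi), ((g t * E' t : ℝ) : ℂ) * e t / (E t - z'))
      = ∫ τ in (0 : ℝ)..1, ∫ t in (0 : ℝ)..(2 * Real.pi),
          (z - z') * (((g t * E' t : ℝ) : ℂ) * e t / (E t - w τ) ^ 2) := by
    have k1 : Continuous fun t => ((g t * E' t : ℝ) : ℂ) * e t / (E t - z) :=
      Continuous.div (by fun_prop) (by fun_prop) fun t => ofReal_sub_ne_zero _ hz
    have k2 : Continuous fun t => ((g t * E' t : ℝ) : ℂ) * e t / (E t - z') :=
      Continuous.div (by fun_prop) (by fun_prop) fun t => ofReal_sub_ne_zero _ hz'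
    rw [intervalIntegral_swap_of_continuousOn zero_le_one (by positivity),
      ← intervalIntegral.integral_sub (k1.intervalIntegrable _ _) (k2.intervalIntegrable _ _)]
    · refine intervalIntegral.integral_congr fun t _ => ?_
      have hne : ∀ τ ∈ Set.Icc (0 : ℝ) 1, (E t : ℂ) - w τ ≠ 0 :=
        fun τ hτ => ofReal_sub_ne_zero _ (hwim τ hτ)
      have hd : ∀ τ ∈ Set.uIcc (0 : ℝ) 1,
          HasDerivAt (fun τ => ((g t * E' t : ℝ) : ℂ) * e t / (E t - w τ))
            ((z - z') * (((g t * E' t : ℝ) : ℂ) * e t / (E t - w τ) ^ 2)) τ := by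
        intro τ hτ
        rw [Set.uIcc_of_le zero_le_one] at hτ
        have h1 : HasDerivAt w (z - z') τ := by
          have := ((hasDerivAt_id (τ : ℂ)).mul_const (z - z')).comp_ofReal.const_add z'
          simp only [id, one_mul] at this
          exact this
        have h2 := (hasDerivAt_const τ (((g t * E' t : ℝ) : ℂ) * e t)).div
          (h1.const_sub (E t : ℂ)) (hne τ hτ)
        refine h2.congr_deriv ?_
        have := hne τ hτ
        field_simp
        ring
      have hci : ContinuousOn (fun τ => (z - z') * (((g t * E' t : ℝ) : ℂ) * e t
          / (E t - w τ) ^ 2)) (Set.uIcc (0 : ℝ) 1) := by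
        rw [Set.uIcc_of_le zero_le_one]
        refine continuousOn_const.mul (ContinuousOn.div (by fun_prop) (by fun_prop) ?_)
        exact fun τ hτ => pow_ne_zero 2 (hne τ hτ)
      have := intervalIntegral.integral_eq_sub_of_hasDerivAt hd hci.intervalIntegrable
      simp only [this]
      simp [hw]
    · refine continuousOn_const.mul (ContinuousOn.div (by fun_prop) (by fun_prop) ?_)
      rintro ⟨τ, t⟩ h
      exact pow_ne_zero 2 (ofReal_sub_ne_zero _ (hwim τ h.1))
  change ‖(∫ t in (0 : ℝ)..(2 * Real.pi), ((g t * E' t : ℝ) : ℂ) * e t / (E t - z))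
      - (∫ t in (0 : ℝ)..(2 * Real.pi), ((g t * E' t : ℝ) : ℂ) * e t / (E t - z'))‖ ≤ _
  rw [hdiff]
  have := intervalIntegral.norm_integral_le_of_norm_le_const (a := (0 : ℝ)) (b := 1)
    (C := C * (1 + |(x : ℝ)|) * ‖z - z'‖) (f := fun τ => ∫ t in (0 : ℝ)..(2 * Real.pi),
          (z - z') * (((g t * E' t : ℝ) : ℂ) * e t / (E t - w τ) ^ 2)) fun τ hτ => ?_
  · simpa using this
  · rw [Set.uIoc_of_le zero_le_one] at hτ
    rw [intervalIntegral.integral_const_mul, norm_mul, mul_comm]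
    exact mul_le_mul_of_nonneg_right (hder τ (Set.Ioc_subset_Icc_self hτ)) (norm_nonneg _)

/-! ### Calculus along coordinate lines of the torus -/

variable {d : ℕ}

/-- The coordinate line in direction `j` through `k`. -/
noncomputable def line (k : Torus d) (j : Fin d) (t : ℝ) : Torus d :=
  k + Pi.single j (t : AddCircle (2 * Real.pi))

theorem continuous_line (j : Fin d) : Continuous fun p : Torus d × ℝ => line p.1 j p.2 := by
  unfold line
  refine continuous_fst.add ((continuous_single j).comp ?_)
  exact (AddCircle.continuous_mk' _).comp continuous_snd

theorem line_add (k : Torus d) (j : Fin d) (s t : ℝ) : line k j (s + t) = line (line k j s) j t := by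
  simp only [line, AddCircle.coe_add, Pi.single_add, add_assoc]

theorem line_periodic (k : Torus d) (j : Fin d) : Function.Periodic (line k j) (2 * Real.pi) := by
  intro t
  simp only [line, AddCircle.coe_add, AddCircle.coe_period, add_zero]

theorem torusProj_add_single (x : EuclideanSpace ℝ (Fin d)) (j : Fin d) (t : ℝ) :
    torusProj (x + t • EuclideanSpace.single j 1) = line (torusProj x) j t := by
  ext i
  by_cases h : i = j
  · subst h
    simp [torusProj, line]
  · simp [torusProj, line, h]

theorem isOpenQuotientMap_torusProj : IsOpenQuotientMap (torusProj (d := d)) := by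
  have h1 : IsOpenQuotientMap (fun x : Fin d → ℝ => fun i => (x i : AddCircle (2 * Real.pi))) :=
    IsOpenQuotientMap.piMap fun _ => QuotientAddGroup.isOpenQuotientMap_mk
  exact h1.comp (PiLp.homeomorph 2 (fun _ : Fin d => ℝ)).isOpenQuotientMap

/-- Smoothness of a function on the torus, through its periodic representative. -/
def TorusSmooth (f : Torus d → ℝ) : Prop :=
  ContDiff ℝ ((⊤ : ℕ∞) : WithTop ℕ∞) fun x : EuclideanSpace ℝ (Fin d) => f (torusProj x)

/-- The partial derivative in direction `j`. -/
noncomputable def partialDeriv (j : Fin d) (f : Torus d → ℝ) (k : Torus d) : ℝ :=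
  deriv (fun t => f (line k j t)) 0

namespace TorusSmooth

variable {f g : Torus d → ℝ}

theorem continuous (hf : TorusSmooth f) : Continuous f :=
  isOpenQuotientMap_torusProj.continuous_comp_iff.mp (ContDiff.continuous hf)

theorem hasDerivAt_zero (hf : TorusSmooth f) (j : Fin d) (x : EuclideanSpace ℝ (Fin d)) :
    HasDerivAt (fun t => f (line (torusProj x) j t))
      (fderiv ℝ (fun x => f (torusProj x)) x (EuclideanSpace.single j 1)) 0 := by
  have h1 : HasFDerivAt (fun x => f (torusProj x)) (fderiv ℝ (fun x => f (torusProj x)) x)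
      (x + (0 : ℝ) • EuclideanSpace.single j (1 : ℝ)) := by
    rw [zero_smul, add_zero]
    exact (hf.differentiable (by simp) x).hasFDerivAt
  have h2 : HasDerivAt (fun t : ℝ => x + t • EuclideanSpace.single j (1 : ℝ))
      (EuclideanSpace.single j 1) 0 := by
    have := ((hasDerivAt_id (0 : ℝ)).smul_const (EuclideanSpace.single j (1 : ℝ))).const_add x
    rw [one_smul] at this
    exact this
  have h3 := h1.comp_hasDerivAt (0 : ℝ) h2
  simpa only [Function.comp_def, torusProj_add_single] using h3

theorem partialDeriv_torusProj (hf : TorusSmooth f) (j : Fin d) (x : EuclideanSpace ℝ (Fin d)) :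
    partialDeriv j f (torusProj x)
      = fderiv ℝ (fun x => f (torusProj x)) x (EuclideanSpace.single j 1) :=
  (hf.hasDerivAt_zero j x).deriv

theorem hasDerivAt_line (hf : TorusSmooth f) (j : Fin d) (k : Torus d) (t : ℝ) :
    HasDerivAt (fun t => f (line k j t)) (partialDeriv j f (line k j t)) t := by
  obtain ⟨x, hx⟩ := isOpenQuotientMap_torusProj.surjective (line k j t)
  have h := hf.hasDerivAt_zero j x
  rw [← hf.partialDeriv_torusProj, hx] at h
  have h2 := (sub_self t ▸ h).comp_sub_const t t
  refine h2.congr_of_eventuallyEq (Filter.Eventually.of_forall fun s => ?_)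
  change f (line k j s) = f (line (line k j t) j (s - t))
  rw [← line_add, add_sub_cancel]

theorem partialDeriv (hf : TorusSmooth f) (j : Fin d) : TorusSmooth (partialDeriv j f) := by
  unfold TorusSmooth
  simp only [hf.partialDeriv_torusProj]
  exact (hf.fderiv_right (m := ((⊤ : ℕ∞) : WithTop ℕ∞)) (by simp)).clm_apply contDiff_const

theorem exists_bound (hf : TorusSmooth f) : ∃ C, 0 ≤ C ∧ ∀ k, |f k| ≤ C := by
  obtain ⟨C, hC⟩ := isCompact_univ.exists_bound_of_continuousOn hf.continuous.continuousOn
  exact ⟨C, (norm_nonneg _).trans (hC 0 trivial), fun k => hC k trivial⟩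

theorem lipschitz_line (hf : TorusSmooth f) {j : Fin d} {C : ℝ}
    (hC : ∀ k, |LAP.partialDeriv j f k| ≤ C) (k : Torus d) (t t' : ℝ) :
    |f (line k j t) - f (line k j t')| ≤ C * |t - t'| := by
  obtain ⟨ξ, -, -, h⟩ := exists_slope_eq (hf.hasDerivAt_line j k) t' t
  rw [h, abs_mul]
  exact mul_le_mul_of_nonneg_right (hC _) (abs_nonneg _)

theorem mul (hf : TorusSmooth f) (hg : TorusSmooth g) : TorusSmooth fun k => f k * g k :=
  ContDiff.mul hf hg

theorem div (hf : TorusSmooth f) (hg : TorusSmooth g) (h : ∀ k, g k ≠ 0) :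
    TorusSmooth fun k => f k / g k :=
  ContDiff.div hf hg fun _ => h _

theorem add (hf : TorusSmooth f) (hg : TorusSmooth g) : TorusSmooth fun k => f k + g k :=
  ContDiff.add hf hg

theorem sub (hf : TorusSmooth f) (hg : TorusSmooth g) : TorusSmooth fun k => f k - g k :=
  ContDiff.sub hf hg

theorem const (c : ℝ) : TorusSmooth fun _ : Torus d => c :=
  contDiff_const

theorem pow (hf : TorusSmooth f) (n : ℕ) : TorusSmooth fun k => f k ^ n :=
  ContDiff.pow hf n

theorem sum {ι : Type*} {s : Finset ι} {F : ι → Torus d → ℝ} (hF : ∀ i ∈ s, TorusSmooth (F i)) :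
    TorusSmooth fun k => ∑ i ∈ s, F i k :=
  ContDiff.sum hF

theorem expNegInvGlue (hf : TorusSmooth f) : TorusSmooth fun k => expNegInvGlue (f k) :=
  _root_.expNegInvGlue.contDiff.comp hf

end TorusSmooth

/-! ### Hölder bounds uniform over coordinate lines -/

theorem periodic_comp_line {β : Type*} (f : Torus d → β) (k : Torus d) (j : Fin d) :
    Function.Periodic (fun t => f (line k j t)) (2 * Real.pi) :=
  fun t => congrArg f (line_periodic k j t)

/-- Interpolation through `min 1 y ≤ y^β`. It is applied with `y = (1 + |x|) ‖z - z'‖`, where the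
two hypotheses are the uniform and the Lipschitz bound. -/
theorem min_le_two_mul_rpow {C N y β : ℝ} (hC : 0 ≤ C) (hy : 0 ≤ y) (h0 : 0 ≤ β) (h1 : β ≤ 1)
    (hN : N ≤ 2 * C) (hN' : N ≤ C * y) : N ≤ 2 * C * y ^ β := by
  rcases le_total 1 y with h | h
  · exact hN.trans (le_mul_of_one_le_right (by positivity) (Real.one_le_rpow h h0))
  · have h2 : y ≤ y ^ β := by
      rcases eq_or_lt_of_le hy with h3 | h3
      · rw [← h3]
        exact Real.rpow_nonneg le_rfl _
      · simpa using Real.rpow_le_rpow_of_exponent_ge h3 h h1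
    have : 0 ≤ y ^ β := Real.rpow_nonneg hy β
    nlinarith

theorem exists_norm_integral_line_sub_le {ℰ g : Torus d → ℝ} (hℰ : TorusSmooth ℰ)
    (hg : TorusSmooth g) {j : Fin d} {c : ℝ} (hc : 0 < c)
    (hgc : ∀ k, g k ≠ 0 → c ≤ |partialDeriv j ℰ k|) :
    ∃ C, 0 ≤ C ∧ ∀ β : ℝ, 0 ≤ β → β ≤ 1 → ∀ (k : Torus d) (x : ℤ) (z z' : ℂ), 0 < z.im * z'.im →
      ‖∫ t in (0 : ℝ)..(2 * Real.pi),
          (((g (line k j t) * partialDeriv j ℰ (line k j t) : ℝ) : ℂ) / (ℰ (line k j t) - z)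
            - ((g (line k j t) * partialDeriv j ℰ (line k j t) : ℝ) : ℂ) / (ℰ (line k j t) - z'))
          * exp (I * x * t)‖ ≤ C * (1 + |(x : ℝ)|) ^ β * ‖z - z'‖ ^ β := by
  have hℰ' := hℰ.partialDeriv j
  have hg' := hg.partialDeriv j
  have ha := hg.mul hℰ'
  obtain ⟨M, hM, hMb⟩ := (hℰ'.partialDeriv j).exists_bound
  obtain ⟨A₀, hA₀, hA₀b⟩ := hg.exists_bound
  obtain ⟨A₁, hA₁, hA₁b⟩ := hg'.exists_bound
  obtain ⟨A₂, hA₂, hA₂b⟩ := (hg'.partialDeriv j).exists_bound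
  obtain ⟨B₀, hB₀, hB₀b⟩ := ha.exists_bound
  obtain ⟨B₁, hB₁, hB₁b⟩ := (ha.partialDeriv j).exists_bound
  obtain ⟨C₁, hC₁, h₁⟩ := exists_norm_integral_cauchy_le hc hM hB₀ hB₁
  obtain ⟨C₂, hC₂, h₂⟩ := exists_norm_integral_cauchy_sub_le hc hM
    (le_max_of_le_left hA₀ : 0 ≤ max A₀ A₁) (le_max_of_le_left hA₁ : 0 ≤ max A₁ A₂)
  refine ⟨2 * max C₁ C₂, by positivity, ?_⟩
  intro β hβ0 hβ1 k x z z' hzz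
  have hz : z.im ≠ 0 := by rintro h; simp [h] at hzz
  have hz' : z'.im ≠ 0 := by rintro h; simp [h] at hzz
  have hb : ∀ z : ℂ, z.im ≠ 0 → _ := fun z hz => h₁ (fun t => ℰ (line k j t))
    (fun t => partialDeriv j ℰ (line k j t)) (fun t => g (line k j t) * partialDeriv j ℰ (line k j t))
    (hℰ.hasDerivAt_line j k) (hℰ'.lipschitz_line hMb k) (fun t => hB₀b _)
    (ha.lipschitz_line hB₁b k) (fun t ht => hgc _ (left_ne_zero_of_mul ht))
    (periodic_comp_line ℰ k j)
    (periodic_comp_line (fun k => g k * partialDeriv j ℰ k) k j) x z hz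
  have hbs := h₂ (fun t => ℰ (line k j t))
    (fun t => partialDeriv j ℰ (line k j t)) (fun t => g (line k j t))
    (fun t => partialDeriv j g (line k j t))
    (hℰ.hasDerivAt_line j k) (hℰ'.lipschitz_line hMb k) (hg.hasDerivAt_line j k)
    (fun t => (hA₀b _).trans (le_max_left _ _))
    (hg.lipschitz_line (fun k => (hA₁b k).trans (le_max_left _ _)) k)
    (fun t => (hA₁b _).trans (le_max_right _ _))
    (hg'.lipschitz_line (fun k => (hA₂b k).trans (le_max_right _ _)) k)
    (fun t ht => hgc _ ht) (periodic_comp_line ℰ k j) (periodic_comp_line g k j)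
    (periodic_comp_line (partialDeriv j g) k j) x z z' hzz
  have hcont : ∀ z : ℂ, z.im ≠ 0 → Continuous fun t : ℝ =>
      ((g (line k j t) * partialDeriv j ℰ (line k j t) : ℝ) : ℂ) * exp (I * x * t)
        / (ℰ (line k j t) - z) := by
    intro z hz
    have hl : Continuous (line k j) := (continuous_line j).comp (by fun_prop : Continuous fun t => (k, t))
    have c1 := hℰ.continuous.comp hl
    have c2 := ha.continuous.comp hl
    simp only [Function.comp_def] at c1 c2
    refine Continuous.div ?_ ((Complex.continuous_ofReal.comp c1).sub continuous_const) fun t => ofReal_sub_ne_zero _ hz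
    exact (Complex.continuous_ofReal.comp c2).mul (by fun_prop)
  have heq : ∫ t in (0 : ℝ)..(2 * Real.pi),
        (((g (line k j t) * partialDeriv j ℰ (line k j t) : ℝ) : ℂ) / (ℰ (line k j t) - z)
          - ((g (line k j t) * partialDeriv j ℰ (line k j t) : ℝ) : ℂ) / (ℰ (line k j t) - z'))
        * exp (I * x * t)
      = (∫ t in (0 : ℝ)..(2 * Real.pi),
          ((g (line k j t) * partialDeriv j ℰ (line k j t) : ℝ) : ℂ) * exp (I * x * t)
            / (ℰ (line k j t) - z))
        - ∫ t in (0 : ℝ)..(2 * Real.pi),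
          ((g (line k j t) * partialDeriv j ℰ (line k j t) : ℝ) : ℂ) * exp (I * x * t)
            / (ℰ (line k j t) - z') := by
    rw [← intervalIntegral.integral_sub ((hcont z hz).intervalIntegrable _ _)
      ((hcont z' hz').intervalIntegrable _ _)]
    refine intervalIntegral.integral_congr fun t _ => ?_
    ring
  rw [heq, mul_assoc, ← Real.mul_rpow (by positivity) (norm_nonneg _)]
  refine min_le_two_mul_rpow (by positivity) (by positivity) hβ0 hβ1 ?_ ?_
  · refine (norm_sub_le _ _).trans ?_
    rw [two_mul (max C₁ C₂)]
    exact add_le_add ((hb z hz).trans (le_max_left _ _)) ((hb z' hz').trans (le_max_left _ _))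
  · rw [← mul_assoc]
    refine hbs.trans ?_
    gcongr
    exact le_max_right _ _

/-! ### A partition subordinate to the nonvanishing of the partial derivatives -/

theorem isCriticalPoint_of_partialDeriv_eq_zero {ℰ : C(Torus d, ℝ)} (hℰ : TorusSmooth ℰ)
    {k : Torus d} (h : ∀ j, partialDeriv j ℰ k = 0) : IsCriticalPoint ℰ k := by
  obtain ⟨x, rfl⟩ := isOpenQuotientMap_torusProj.surjective k
  refine ⟨x, rfl, ?_⟩
  have h0 : fderiv ℝ (lift ℰ) x = 0 := by
    refine ContinuousLinearMap.coe_injective ((EuclideanSpace.basisFun (Fin d) ℝ).toBasis.ext fun j => ?_)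
    have : fderiv ℝ (lift ℰ) x (EuclideanSpace.single j 1) = 0 :=
      (hℰ.partialDeriv_torusProj j x).symm.trans (h j)
    simpa using this
  rw [gradient, h0, map_zero]

/-- A smooth form of `ρ = ∑ⱼ (ρ ∂ⱼℰ / |∇ℰ|²) ∂ⱼℰ`, with each term cut off by `χⱼ` where `∂ⱼℰ` is
small and the denominator adjusted accordingly. Keeping `∂ⱼℰ` as an explicit factor prepares the
integration by parts along lines. -/
theorem exists_smooth_partition (hd : 0 < d) {ℰ ρ : C(Torus d, ℝ)} (hℰ : TorusSmooth ℰ)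
    (hρ : TorusSmooth ρ) (hsupp : ∀ k ∈ tsupport (ρ : Torus d → ℝ), ¬ IsCriticalPoint ℰ k) :
    ∃ c > 0, ∃ g : Fin d → Torus d → ℝ, (∀ j, TorusSmooth (g j)) ∧
      (∀ j k, g j k ≠ 0 → c ≤ |partialDeriv j ℰ k|) ∧
      ∀ k, ρ k = ∑ j, g j k * partialDeriv j ℰ k := by
  have hD := fun j => hℰ.partialDeriv j
  have hNs : TorusSmooth fun k => ∑ j, partialDeriv j ℰ k ^ 2 := TorusSmooth.sum fun j _ => (hD j).pow 2
  obtain ⟨m, hm, hmρ⟩ : ∃ m > 0, ∀ k, ρ k ≠ 0 → m ≤ ∑ j, partialDeriv j ℰ k ^ 2 := by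
    rcases (tsupport (ρ : Torus d → ℝ)).eq_empty_or_nonempty with he | hne
    · refine ⟨1, one_pos, fun k hk => ?_⟩
      have := subset_tsupport (ρ : Torus d → ℝ) hk
      rw [he] at this
      exact absurd this (Set.notMem_empty k)
    · obtain ⟨k₀, hk₀, hmin⟩ := (isClosed_tsupport (ρ : Torus d → ℝ)).isCompact.exists_isMinOn hne
        hNs.continuous.continuousOn
      refine ⟨∑ j, partialDeriv j ℰ k₀ ^ 2, ?_, fun k hk => hmin (subset_tsupport _ hk)⟩
      refine lt_of_le_of_ne (Finset.sum_nonneg fun j _ => sq_nonneg _) fun h0 => hsupp k₀ hk₀ ?_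
      refine isCriticalPoint_of_partialDeriv_eq_zero hℰ fun j => ?_
      have := (Finset.sum_eq_zero_iff_of_nonneg fun j _ => sq_nonneg _).mp h0.symm j (Finset.mem_univ j)
      exact pow_eq_zero_iff (two_ne_zero) |>.mp this
  have hd' : (0 : ℝ) < d := by exact_mod_cast hd
  -- Strictly below `m / d`: wherever `|∇ℰ|² ≥ m`, some `(∂ⱼℰ)²` exceeds `μ`.
  set μ := m / (2 * d) with hμ
  have hμpos : 0 < μ := by positivity
  set χ : Fin d → Torus d → ℝ := fun j k => expNegInvGlue (partialDeriv j ℰ k ^ 2 - μ) with hχ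
  have hχs : ∀ j, TorusSmooth (χ j) := fun j => (((hD j).pow 2).sub (.const μ)).expNegInvGlue
  have hχ0 : ∀ j k, 0 ≤ χ j k := fun j k => expNegInvGlue.nonneg _
  -- The last summand keeps `S` positive where `|∇ℰ|² < m` and is zero wherever `ρ ≠ 0`, so it does
  -- not disturb the identity for `ρ`.
  set S : Torus d → ℝ := fun k => ∑ j, partialDeriv j ℰ k ^ 2 * χ j k
    + expNegInvGlue (m - ∑ j, partialDeriv j ℰ k ^ 2) with hS
  have hSs : TorusSmooth S :=
    (TorusSmooth.sum fun j _ => ((hD j).pow 2).mul (hχs j)).add ((TorusSmooth.const m).sub hNs).expNegInvGlue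
  have hSpos : ∀ k, 0 < S k := by
    intro k
    have hsum0 : 0 ≤ ∑ j, partialDeriv j ℰ k ^ 2 * χ j k :=
      Finset.sum_nonneg fun j _ => mul_nonneg (sq_nonneg _) (hχ0 j k)
    rcases lt_or_ge (∑ j, partialDeriv j ℰ k ^ 2) m with h | h
    · exact add_pos_of_nonneg_of_pos hsum0 (expNegInvGlue.pos_of_pos (sub_pos.mpr h))
    · refine add_pos_of_pos_of_nonneg ?_ (expNegInvGlue.nonneg _)
      obtain ⟨j, hj⟩ : ∃ j, μ < partialDeriv j ℰ k ^ 2 := by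
        by_contra hcon
        push Not at hcon
        have h1 : ∑ j, partialDeriv j ℰ k ^ 2 ≤ ∑ _j : Fin d, μ := Finset.sum_le_sum fun j _ => hcon j
        have h2 : ∑ _j : Fin d, μ = m / 2 := by
          rw [Finset.sum_const, Finset.card_univ, Fintype.card_fin, nsmul_eq_mul, hμ]
          field_simp
        linarith
      refine Finset.sum_pos' (fun j _ => mul_nonneg (sq_nonneg _) (hχ0 j k)) ⟨j, Finset.mem_univ j, ?_⟩
      exact mul_pos (hμpos.trans hj) (expNegInvGlue.pos_of_pos (sub_pos.mpr hj))
  refine ⟨Real.sqrt μ, Real.sqrt_pos.mpr hμpos,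
    fun j k => ρ k * (partialDeriv j ℰ k * χ j k) / S k, fun j => ?_, fun j k hk => ?_, fun k => ?_⟩
  · exact (hρ.mul ((hD j).mul (hχs j))).div hSs fun k => (hSpos k).ne'
  · refine Real.sqrt_le_iff.mpr ⟨abs_nonneg _, ?_⟩
    rw [sq_abs]
    by_contra hlt
    push Not at hlt
    apply hk
    have : χ j k = 0 := expNegInvGlue.zero_of_nonpos (by linarith)
    simp [this]
  · have h1 : ∀ j, ρ k * (partialDeriv j ℰ k * χ j k) / S k * partialDeriv j ℰ k
        = ρ k / S k * (partialDeriv j ℰ k ^ 2 * χ j k) := fun j => by ring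
    simp only [h1]
    rw [← Finset.mul_sum]
    by_cases hk : ρ k = 0
    · simp [hk]
    · have h2 : expNegInvGlue (m - ∑ j, partialDeriv j ℰ k ^ 2) = 0 :=
        expNegInvGlue.zero_of_nonpos (by linarith [hmρ k hk])
      have h3 : ∑ j, partialDeriv j ℰ k ^ 2 * χ j k = S k := by
        simp only [hS, h2, add_zero]
      rw [h3, div_mul_cancel₀ _ (hSpos k).ne']

/-! ### Fourier multipliers with complex symbols -/

/-- The operator on `L²(𝕋^d)` of multiplication by a continuous complex function. -/
noncomputable def cmulOp (w : C(Torus d, ℂ)) : L2Torus d →L[ℂ] L2Torus d :=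
  (ContinuousLinearMap.mul ℂ ℂ).holderL volume ∞ 2 2 (ContinuousMap.toLp (E := ℂ) ∞ volume ℂ w)

theorem cmulOp_ae_eq (w : C(Torus d, ℂ)) (φ : L2Torus d) :
    cmulOp w φ =ᵐ[volume] fun k => w k * φ k := by
  have h1 := ContinuousLinearMap.coeFn_holder (r := 2) (ContinuousLinearMap.mul ℂ ℂ)
    (ContinuousMap.toLp (E := ℂ) ∞ (volume : Measure (Torus d)) ℂ w) φ
  have h2 := ContinuousMap.coeFn_toLp (p := ∞) (𝕜 := ℂ) (volume : Measure (Torus d)) w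
  refine h1.trans ?_
  filter_upwards [h2] with k hk
  rw [hk]
  rfl

/-- The complexification of a continuous real function. -/
noncomputable def toComplex (f : C(Torus d, ℝ)) : C(Torus d, ℂ) :=
  ⟨fun k => (f k : ℂ), Complex.continuous_ofReal.comp f.continuous⟩

theorem mulOp_eq_cmulOp (f : C(Torus d, ℝ)) : mulOp f = cmulOp (toComplex f) := rfl

theorem cmulOp_mul (w w' : C(Torus d, ℂ)) : cmulOp (w * w') = cmulOp w ∘L cmulOp w' := by
  ext1 φ
  refine Lp.ext ?_
  filter_upwards [cmulOp_ae_eq (w * w') φ, cmulOp_ae_eq w (cmulOp w' φ), cmulOp_ae_eq w' φ]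
    with k h1 h2 h3
  rw [h1, ContinuousLinearMap.comp_apply, h2, h3, ContinuousMap.mul_apply, mul_assoc]

theorem cmulOp_one : cmulOp (1 : C(Torus d, ℂ)) = ContinuousLinearMap.id ℂ _ := by
  ext1 φ
  refine Lp.ext ?_
  filter_upwards [cmulOp_ae_eq 1 φ] with k h1
  rw [h1, ContinuousMap.one_apply, one_mul, ContinuousLinearMap.id_apply]

theorem cmulOp_toLp (w v : C(Torus d, ℂ)) :
    cmulOp w (ContinuousMap.toLp (E := ℂ) 2 volume ℂ v)
      = ContinuousMap.toLp (E := ℂ) 2 volume ℂ (w * v) := by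
  refine Lp.ext ?_
  filter_upwards [cmulOp_ae_eq w (ContinuousMap.toLp (E := ℂ) 2 volume ℂ v),
    ContinuousMap.coeFn_toLp (p := 2) (𝕜 := ℂ) (volume : Measure (Torus d)) v,
    ContinuousMap.coeFn_toLp (p := 2) (𝕜 := ℂ) (volume : Measure (Torus d)) (w * v)]
    with k h1 h2 h3
  rw [h1, h2, h3, ContinuousMap.mul_apply]

/-- The operator `ℱ* w ℱ` on `ℓ²(ℤ^d)`, for a continuous complex function `w` on the torus. -/
noncomputable def cmultiplier (w : C(Torus d, ℂ)) : Ell2 d →L[ℂ] Ell2 d :=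
  ((fourierT d).symm.toContinuousLinearEquiv : L2Torus d →L[ℂ] Ell2 d) ∘L cmulOp w ∘L
    ((fourierT d).toContinuousLinearEquiv : Ell2 d →L[ℂ] L2Torus d)

theorem cmultiplier_apply (w : C(Torus d, ℂ)) (φ : Ell2 d) :
    cmultiplier w φ = (fourierT d).symm (cmulOp w (fourierT d φ)) := rfl

theorem fourierMultiplier_eq_cmultiplier (f : C(Torus d, ℝ)) :
    fourierMultiplier f = cmultiplier (toComplex f) := rfl

theorem cmultiplier_mul (w w' : C(Torus d, ℂ)) :
    cmultiplier (w * w') = cmultiplier w ∘L cmultiplier w' := by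
  ext1 φ
  rw [ContinuousLinearMap.comp_apply, cmultiplier_apply, cmultiplier_apply, cmultiplier_apply,
    LinearIsometryEquiv.apply_symm_apply, cmulOp_mul, ContinuousLinearMap.comp_apply]

theorem cmultiplier_one : cmultiplier (1 : C(Torus d, ℂ)) = ContinuousLinearMap.id ℂ _ := by
  ext1 φ
  rw [cmultiplier_apply, cmulOp_one, ContinuousLinearMap.id_apply,
    LinearIsometryEquiv.symm_apply_apply, ContinuousLinearMap.id_apply]

theorem cmultiplier_sub (w w' : C(Torus d, ℂ)) :
    cmultiplier (w - w') = cmultiplier w - cmultiplier w' := by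
  simp only [cmultiplier, cmulOp, map_sub, ContinuousLinearMap.sub_comp, ContinuousLinearMap.comp_sub]

theorem cmultiplier_smul (c : ℂ) (w : C(Torus d, ℂ)) :
    cmultiplier (c • w) = c • cmultiplier w := by
  ext1 φ
  simp only [cmultiplier_apply, cmulOp, map_smul, smul_apply]

theorem cmultiplier_sum {ι : Type*} (s : Finset ι) (w : ι → C(Torus d, ℂ)) :
    cmultiplier (∑ i ∈ s, w i) = ∑ i ∈ s, cmultiplier (w i) := by
  ext1 φ
  simp only [cmultiplier_apply, cmulOp, map_sum, sum_apply]

/-- The symbol `(ℰ - z)⁻¹` of the resolvent at a non-real point. -/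
noncomputable def resolventSymbol (ℰ : C(Torus d, ℝ)) {z : ℂ} (hz : z.im ≠ 0) : C(Torus d, ℂ) :=
  ⟨fun k => 1 / ((ℰ k : ℂ) - z), Continuous.div continuous_const
    ((Complex.continuous_ofReal.comp ℰ.continuous).sub continuous_const)
    fun _ => ofReal_sub_ne_zero _ hz⟩

theorem resolventOp_eq_cmultiplier {H : Ell2 d →L[ℂ] Ell2 d} {ℰ : C(Torus d, ℝ)}
    (hH : HasSymbol H ℰ) {z : ℂ} (hz : z.im ≠ 0) :
    resolventOp H z = cmultiplier (resolventSymbol ℰ hz) := by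
  have h1 : H = cmultiplier (toComplex ℰ) := by
    ext1 φ
    have := DFunLike.congr_fun hH (fourierT d φ)
    rw [mulOp_eq_cmulOp] at this
    rw [cmultiplier_apply, ← this]
    simp
  have h2 : H - z • ContinuousLinearMap.id ℂ (Ell2 d) = cmultiplier (toComplex ℰ - z • 1) := by
    rw [cmultiplier_sub, cmultiplier_smul, cmultiplier_one, ← h1]
  have h3 : (toComplex ℰ - z • 1) * resolventSymbol ℰ hz = 1 := by
    ext k
    have := ofReal_sub_ne_zero (ℰ k) hz
    simp [toComplex, resolventSymbol, this]
  have h4 : cmultiplier (toComplex ℰ - z • 1) * cmultiplier (resolventSymbol ℰ hz) = 1 := by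
    rw [ContinuousLinearMap.mul_def, ← cmultiplier_mul, h3, cmultiplier_one]
    rfl
  have h5 : cmultiplier (resolventSymbol ℰ hz) * cmultiplier (toComplex ℰ - z • 1) = 1 := by
    rw [ContinuousLinearMap.mul_def, ← cmultiplier_mul, mul_comm, h3, cmultiplier_one]
    rfl
  rw [resolventOp, h2]
  exact Ring.inverse_unit ⟨_, _, h4, h5⟩

/-! ### Slices of trigonometric polynomials -/

theorem expo_line (n : Fin d → ℤ) (k : Torus d) (j : Fin d) (t : ℝ) :
    expo n (line k j t) = exp (-(I * (n j : ℤ) * t)) * expo n k := by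
  obtain ⟨x, rfl⟩ := isOpenQuotientMap_torusProj.surjective k
  rw [← torusProj_add_single]
  change expo n (fun i => ((x + t • EuclideanSpace.single j (1 : ℝ)) i : AddCircle (2 * Real.pi)))
    = _ * expo n (fun i => (x i : AddCircle (2 * Real.pi)))
  rw [expo_apply_coe, expo_apply_coe, ← Complex.exp_add]
  congr 1
  have h : ∀ i, (((x + t • EuclideanSpace.single j (1 : ℝ)) i : ℝ) : ℂ) * (n i : ℂ)
      = (x i : ℂ) * n i + (if i = j then (t : ℂ) * n i else 0) := by
    intro i
    by_cases hij : i = j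
    · subst hij
      simp
      ring
    · simp [hij]
  simp only [h, Finset.sum_add_distrib, Finset.sum_ite_eq', Finset.mem_univ, if_true]
  ring

theorem norm_toLp_norm_le (u : C(Torus d, ℂ)) :
    ‖ContinuousMap.toLp (E := ℂ) 2 (volume : Measure (Torus d)) ℂ
      ⟨fun k => ((‖u k‖ : ℝ) : ℂ), Complex.continuous_ofReal.comp u.continuous.norm⟩‖
      ≤ ‖ContinuousMap.toLp (E := ℂ) 2 (volume : Measure (Torus d)) ℂ u‖ := by
  refine Lp.norm_le_norm_of_ae_le ?_
  filter_upwards [ContinuousMap.coeFn_toLp (p := 2) (𝕜 := ℂ) (volume : Measure (Torus d)) u,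
    ContinuousMap.coeFn_toLp (p := 2) (𝕜 := ℂ) (volume : Measure (Torus d))
      (⟨fun k => ((‖u k‖ : ℝ) : ℂ), Complex.continuous_ofReal.comp u.continuous.norm⟩ :
        C(Torus d, ℂ))] with k h1 h2
  rw [h1, h2, ContinuousMap.coe_mk, Complex.norm_real, norm_norm]

theorem integral_norm_mul_norm_le (u v : C(Torus d, ℂ)) :
    ∫ k : Torus d, ‖u k‖ * ‖v k‖
      ≤ ‖ContinuousMap.toLp (E := ℂ) 2 (volume : Measure (Torus d)) ℂ u‖
        * ‖ContinuousMap.toLp (E := ℂ) 2 (volume : Measure (Torus d)) ℂ v‖ := by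
  have h := (norm_inner_le_norm (𝕜 := ℂ) _ _).trans
    (mul_le_mul (norm_toLp_norm_le u) (norm_toLp_norm_le v) (norm_nonneg _) (norm_nonneg _))
  rw [ContinuousMap.inner_toLp] at h
  refine le_trans (le_of_eq ?_) h
  have h2 : ∀ k, ((‖v k‖ : ℝ) : ℂ) * conj ((‖u k‖ : ℝ) : ℂ) = ((‖u k‖ * ‖v k‖ : ℝ) : ℂ) := by
    intro k
    rw [Complex.conj_ofReal]
    push_cast
    ring
  simp only [ContinuousMap.coe_mk, h2]
  rw [integral_complex_ofReal, Complex.norm_real, Real.norm_of_nonneg]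
  exact integral_nonneg fun k => by positivity

/-- Translation invariance of the measure on the torus together with Fubini; averaging over all
starting points `k` avoids splitting off the `j`-th coordinate. -/
theorem integral_eq_integral_average (F : C(Torus d, ℂ)) (j : Fin d) :
    ((2 * Real.pi : ℝ) : ℂ) * ∫ k, F k
      = ∫ k, ∫ t in (0 : ℝ)..(2 * Real.pi), F (line k j t) := by
  have hpi := Real.pi_pos
  have hcont : Continuous (Function.uncurry fun (t : ℝ) (k : Torus d) => F (line k j t)) :=
    F.continuous.comp ((continuous_line j).comp continuous_swap)
  rw [← MeasureTheory.intervalIntegral_integral_swap (f := fun t k => F (line k j t))]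
  · have : ∀ t : ℝ, ∫ k, F (line k j t) = ∫ k, F k := fun t =>
      integral_add_right_eq_self F (Pi.single j (t : AddCircle (2 * Real.pi)))
    simp [this]
  · have h : IntegrableOn (Function.uncurry fun (t : ℝ) (k : Torus d) => F (line k j t))
        (Set.Icc 0 (2 * Real.pi) ×ˢ Set.univ) ((volume : Measure ℝ).prod volume) :=
      hcont.continuousOn.integrableOn_compact (isCompact_Icc.prod isCompact_univ)
    rw [IntegrableOn, ← Measure.prod_restrict, Measure.restrict_univ] at h
    rw [Set.uIoc_of_le (by positivity)]
    refine h.mono_measure ?_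
    exact Measure.prod_mono (Measure.restrict_mono Set.Ioc_subset_Icc_self le_rfl) le_rfl

/-- Along a line, `v * conj u` is a constant times `e^{i(p-q)t}`, so the line integral sees `w` only
through one of its one-dimensional Fourier coefficients. What remains is Cauchy–Schwarz on the
torus. -/
theorem norm_inner_slice_le {w u v : C(Torus d, ℂ)} {j : Fin d} {p q : ℤ} {K : ℝ}
    (hu : ∀ k t, u (line k j t) = exp (-(I * p * t)) * u k)
    (hv : ∀ k t, v (line k j t) = exp (-(I * q * t)) * v k)
    (hw : ∀ k, ‖∫ t in (0 : ℝ)..(2 * Real.pi), w (line k j t) * exp (I * (p - q : ℤ) * t)‖ ≤ K) :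
    2 * Real.pi * ‖inner ℂ (ContinuousMap.toLp (E := ℂ) 2 (volume : Measure (Torus d)) ℂ u)
        (cmulOp w (ContinuousMap.toLp (E := ℂ) 2 (volume : Measure (Torus d)) ℂ v))‖
      ≤ K * (‖ContinuousMap.toLp (E := ℂ) 2 (volume : Measure (Torus d)) ℂ u‖
        * ‖ContinuousMap.toLp (E := ℂ) 2 (volume : Measure (Torus d)) ℂ v‖) := by
  have hpi := Real.pi_pos
  have hK : 0 ≤ K := (norm_nonneg _).trans (hw 0)
  rw [cmulOp_toLp, ContinuousMap.inner_toLp]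
  have h1 := integral_eq_integral_average (w * v * star u) j
  have h2 : ∀ k, ∫ t in (0 : ℝ)..(2 * Real.pi), (w * v * star u) (line k j t)
      = (v k * conj (u k)) * ∫ t in (0 : ℝ)..(2 * Real.pi),
        w (line k j t) * exp (I * (p - q : ℤ) * t) := by
    intro k
    rw [← intervalIntegral.integral_const_mul]
    refine intervalIntegral.integral_congr fun t _ => ?_
    simp only [ContinuousMap.mul_apply, ContinuousMap.star_apply, hu, hv, star_mul,
      RCLike.star_def, ← Complex.exp_conj, map_neg, map_mul, Complex.conj_I, Complex.conj_ofReal,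
      map_intCast]
    have : exp (I * (p - q : ℤ) * t) = exp (-(I * q * t)) * exp (-(-I * p * t)) := by
      rw [← Complex.exp_add]
      congr 1
      push_cast
      ring
    rw [this]
    ring
  simp only [h2] at h1
  have h3 : 2 * Real.pi * ‖∫ k, (w * v) k * conj (u k)‖
      = ‖((2 * Real.pi : ℝ) : ℂ) * ∫ k, (w * v * star u) k‖ := by
    rw [norm_mul, Complex.norm_real, Real.norm_of_nonneg (by positivity)]
    rfl
  rw [h3, h1]
  have hint : Integrable fun k : Torus d => K * (‖u k‖ * ‖v k‖) := by
    have : ContinuousOn (fun k : Torus d => K * (‖u k‖ * ‖v k‖)) Set.univ :=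
      Continuous.continuousOn (by fun_prop)
    exact integrableOn_univ.mp (this.integrableOn_compact isCompact_univ)
  refine (MeasureTheory.norm_integral_le_of_norm_le hint (Filter.Eventually.of_forall fun k => ?_)).trans ?_
  · rw [norm_mul, norm_mul, RCLike.norm_conj, mul_comm, mul_comm ‖u k‖]
    gcongr
    exact hw k
  · rw [MeasureTheory.integral_const_mul]
    gcongr
    exact integral_norm_mul_norm_le u v

/-! ### The weighted operator norm estimate -/

/-- The trigonometric polynomial with coefficients `a` and frequencies in `s`. -/
noncomputable def trigPoly (s : Finset (Fin d → ℤ)) (a : (Fin d → ℤ) → ℂ) : C(Torus d, ℂ) :=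
  ∑ n ∈ s, a n • ((((2 * Real.pi) ^ (-(d : ℝ) / 2) : ℝ) : ℂ) • expo n)

theorem toLp_trigPoly (s : Finset (Fin d → ℤ)) (a : (Fin d → ℤ) → ℂ) :
    ContinuousMap.toLp (E := ℂ) 2 (volume : Measure (Torus d)) ℂ (trigPoly s a)
      = ∑ n ∈ s, a n • expoL2 n := by
  rw [trigPoly, map_sum]
  exact Finset.sum_congr rfl fun n _ => map_smul _ _ _

theorem trigPoly_line {s : Finset (Fin d → ℤ)} {j : Fin d} {p : ℤ} (hs : ∀ n ∈ s, n j = p)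
    (a : (Fin d → ℤ) → ℂ) (k : Torus d) (t : ℝ) :
    trigPoly s a (line k j t) = exp (-(I * p * t)) * trigPoly s a k := by
  simp only [trigPoly, ContinuousMap.sum_apply, ContinuousMap.smul_apply, smul_eq_mul,
    Finset.mul_sum]
  refine Finset.sum_congr rfl fun n hn => ?_
  rw [expo_line, hs n hn]
  ring

theorem norm_sq_sum_expoL2 (s : Finset (Fin d → ℤ)) (a : (Fin d → ℤ) → ℂ) :
    ‖∑ n ∈ s, a n • expoL2 n‖ ^ 2 = ∑ n ∈ s, ‖a n‖ ^ 2 := by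
  have h := (orthonormal_expoL2 d).inner_sum a a s
  have h2 := inner_self_eq_norm_sq_to_K (𝕜 := ℂ) (∑ n ∈ s, a n • expoL2 n)
  rw [h] at h2
  have h3 : ∀ n, conj (a n) * a n = ((‖a n‖ ^ 2 : ℝ) : ℂ) := fun n => by
    rw [Complex.conj_mul']
    push_cast
    rfl
  simp only [h3] at h2
  have h4 : ((∑ n ∈ s, ‖a n‖ ^ 2 : ℝ) : ℂ) = ((‖∑ n ∈ s, a n • expoL2 n‖ ^ 2 : ℝ) : ℂ) := by
    push_cast at h2 ⊢
    exact h2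
  exact_mod_cast h4.symm

theorem one_add_abs_le_japanese (n : Fin d → ℤ) (j : Fin d) :
    1 + |(n j : ℝ)| ≤ 2 * japanese n := by
  have h1 := one_le_japanese n
  have h2 : |(n j : ℝ)| ≤ japanese n := by
    refine Real.abs_le_sqrt ?_
    have := Finset.single_le_sum (f := fun i => (n i : ℝ) ^ 2) (fun i _ => sq_nonneg _)
      (Finset.mem_univ j)
    linarith
  linarith

theorem japanese_rpow_neg_le (n : Fin d → ℤ) (j : Fin d) {α : ℝ} (hα : 0 ≤ α) :
    japanese n ^ (-α) ≤ 2 ^ α * (1 + |(n j : ℝ)|) ^ (-α) := by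
  have h0 : 0 < japanese n := one_pos.trans_le (one_le_japanese n)
  have h1 : 0 < 1 + |(n j : ℝ)| := by positivity
  rw [Real.rpow_neg h0.le, Real.rpow_neg h1.le, ← div_eq_mul_inv, inv_eq_one_div,
    div_le_div_iff₀ (by positivity) (by positivity), one_mul, ← Real.mul_rpow two_pos.le h0.le]
  exact Real.rpow_le_rpow h1.le (one_add_abs_le_japanese n j) hα

theorem summable_one_add_abs_rpow {b : ℝ} (hb : b < -1) :
    Summable fun p : ℤ => (1 + |(p : ℝ)|) ^ b := by
  have h := (summable_nat_add_iff 1).mpr (Real.summable_nat_rpow.mpr hb)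
  refine Summable.of_nat_of_neg (h.congr fun n => ?_) (h.congr fun n => ?_)
  · push_cast
    rw [abs_of_nonneg (Nat.cast_nonneg n), add_comm]
  · push_cast
    rw [abs_neg, abs_of_nonneg (Nat.cast_nonneg n), add_comm]

/-- The square of the norm of the one-dimensional weight, `∑ₚ (1 + |p|)^{2γ}`. -/
noncomputable def weightSum (γ : ℝ) : ℝ := ∑' p : ℤ, (1 + |(p : ℝ)|) ^ (2 * γ)

/-- The part of `s` in the slice `n j = p`. -/
abbrev slice (s : Finset (Fin d → ℤ)) (j : Fin d) (p : ℤ) : Finset (Fin d → ℤ) :=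
  s.filter fun n => n j = p

/-- Only the decay of the weight in the single coordinate `n j` is used. By Cauchy–Schwarz in `p`,
the factor `(1 + |p|)^{β - α}` is square summable exactly because `2(β - α) < -1`, and the slice
norms add up to at most `‖f‖²`. -/
theorem sum_weighted_slice_norm_le {α β : ℝ} (hα : 0 ≤ α) (hαβ : β < α - 1 / 2)
    (s : Finset (Fin d → ℤ)) (j : Fin d) (f : Ell2 d) :
    ∑ p ∈ s.image (fun n : Fin d → ℤ => n j), (1 + |(p : ℝ)|) ^ β
        * ‖∑ n ∈ slice s j p, (((japanese n ^ (-α) : ℝ) : ℂ) * f n) • expoL2 n‖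
      ≤ 2 ^ α * Real.sqrt (weightSum (β - α)) * ‖f‖ := by
  set P := s.image fun n => n j
  have hslice : ∀ p, ‖∑ n ∈ slice s j p, (((japanese n ^ (-α) : ℝ) : ℂ) * f n) • expoL2 n‖
      ≤ 2 ^ α * (1 + |(p : ℝ)|) ^ (-α) * Real.sqrt (∑ n ∈ slice s j p, ‖f n‖ ^ 2) := by
    intro p
    have hW : 0 ≤ 2 ^ α * (1 + |(p : ℝ)|) ^ (-α) := by positivity
    refine le_of_sq_le_sq ?_ (by positivity)
    rw [norm_sq_sum_expoL2, mul_pow, Real.sq_sqrt (by positivity), Finset.mul_sum]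
    refine Finset.sum_le_sum fun n hn => ?_
    have hnp : n j = p := (Finset.mem_filter.mp hn).2
    have hJ : 0 ≤ japanese n ^ (-α) :=
      Real.rpow_nonneg (zero_le_one.trans (one_le_japanese n)) _
    rw [norm_mul, Complex.norm_real, Real.norm_of_nonneg hJ, mul_pow]
    gcongr
    rw [← hnp]
    exact japanese_rpow_neg_le n j hα
  have h1 : ∑ p ∈ P, (1 + |(p : ℝ)|) ^ β
        * ‖∑ n ∈ slice s j p, (((japanese n ^ (-α) : ℝ) : ℂ) * f n) • expoL2 n‖
      ≤ 2 ^ α * ∑ p ∈ P, (1 + |(p : ℝ)|) ^ (β - α) * Real.sqrt (∑ n ∈ slice s j p, ‖f n‖ ^ 2) := by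
    rw [Finset.mul_sum]
    refine Finset.sum_le_sum fun p _ => ?_
    refine (mul_le_mul_of_nonneg_left (hslice p) (by positivity)).trans (le_of_eq ?_)
    rw [sub_eq_add_neg, Real.rpow_add (by positivity)]
    ring
  have hsum := summable_one_add_abs_rpow (b := 2 * (β - α)) (by linarith)
  have h2 : ∑ p ∈ P, ((1 + |(p : ℝ)|) ^ (β - α)) ^ 2 ≤ weightSum (β - α) := by
    refine le_trans (le_of_eq ?_) (hsum.sum_le_tsum P fun p _ => by positivity)
    refine Finset.sum_congr rfl fun p _ => ?_
    rw [← Real.rpow_natCast, ← Real.rpow_mul (by positivity), mul_comm]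
    norm_num
  have h3 : ∑ p ∈ P, Real.sqrt (∑ n ∈ slice s j p, ‖f n‖ ^ 2) ^ 2 ≤ ‖f‖ ^ 2 := by
    have : ∀ p, Real.sqrt (∑ n ∈ slice s j p, ‖f n‖ ^ 2) ^ 2 = ∑ n ∈ slice s j p, ‖f n‖ ^ 2 :=
      fun p => Real.sq_sqrt (by positivity)
    simp only [this]
    rw [Finset.sum_fiberwise_of_maps_to fun n hn => Finset.mem_image_of_mem _ hn]
    have h := lp.sum_rpow_le_norm_rpow (p := 2) (by norm_num) f s
    simpa using h
  have h4 := Real.sum_mul_le_sqrt_mul_sqrt P (fun p => (1 + |(p : ℝ)|) ^ (β - α))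
    fun p => Real.sqrt (∑ n ∈ slice s j p, ‖f n‖ ^ 2)
  have h5 : Real.sqrt (∑ p ∈ P, Real.sqrt (∑ n ∈ slice s j p, ‖f n‖ ^ 2) ^ 2) ≤ ‖f‖ :=
    Real.sqrt_le_iff.mpr ⟨norm_nonneg _, h3⟩
  refine h1.trans ?_
  rw [mul_assoc]
  gcongr
  refine h4.trans ?_
  gcongr

theorem inner_damping (α : ℝ) (hα : 0 ≤ α) (φ ψ : Ell2 d) :
    inner ℂ φ (damping d α hα ψ) = inner ℂ (damping d α hα φ) ψ := by
  rw [lp.inner_eq_tsum, lp.inner_eq_tsum]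
  refine tsum_congr fun n => ?_
  rw [damping_apply, damping_apply]
  simp only [RCLike.inner_apply, map_mul, Complex.conj_ofReal]
  ring

theorem fourierT_damping_sum (α : ℝ) (hα : 0 ≤ α) (s : Finset (Fin d → ℤ)) (f : Ell2 d) :
    fourierT d (damping d α hα (∑ n ∈ s, lp.single 2 n (f n)))
      = ∑ n ∈ s, (((japanese n ^ (-α) : ℝ) : ℂ) * f n) • expoL2 n := by
  rw [map_sum, map_sum]
  refine Finset.sum_congr rfl fun n _ => ?_
  have : damping d α hα (lp.single 2 n (f n)) = (((japanese n ^ (-α) : ℝ) : ℂ) * f n) • ket n := by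
    ext m
    rw [damping_apply, ket]
    by_cases h : m = n
    · subst h
      simp
    · simp [h]
  rw [this, map_smul, fourierT_ket]

/-- The block between slices `p` and `q` is bounded by `K (1 + |p - q|)^β`, hence by a product of a
function of `p` and a function of `q`. The double sum then factorizes into two weighted slice sums.
The estimate is made for finitely supported vectors and extended by continuity. -/
theorem norm_damping_cmultiplier_damping_le {α β K : ℝ} (hα : 0 ≤ α) (hβ : 0 ≤ β)
    (hαβ : β < α - 1 / 2) (hK : 0 ≤ K) {w : C(Torus d, ℂ)} {j : Fin d}
    (hw : ∀ (k : Torus d) (x : ℤ),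
      ‖∫ t in (0 : ℝ)..(2 * Real.pi), w (line k j t) * exp (I * x * t)‖
        ≤ K * (1 + |(x : ℝ)|) ^ β) :
    ‖damping d α hα ∘L cmultiplier w ∘L damping d α hα‖
      ≤ (2 ^ α * Real.sqrt (weightSum (β - α))) ^ 2 * K := by
  have hpi := Real.pi_gt_three
  set T := damping d α hα ∘L cmultiplier w ∘L damping d α hα with hT
  set Q := 2 ^ α * Real.sqrt (weightSum (β - α)) with hQ
  have hQ0 : 0 ≤ Q := by positivity
  have hfin : ∀ (s : Finset (Fin d → ℤ)) (f g : Ell2 d),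
      ‖inner ℂ (∑ n ∈ s, lp.single 2 n (f n) : Ell2 d) (T (∑ n ∈ s, lp.single 2 n (g n)))‖
        ≤ Q ^ 2 * K * ‖f‖ * ‖g‖ := by
    intro s f g
    set U : Ell2 d → ℤ → L2Torus d := fun f p =>
      ∑ n ∈ slice s j p, (((japanese n ^ (-α) : ℝ) : ℂ) * f n) • expoL2 n with hU
    set P := s.image fun n => n j
    have hF : ∀ f : Ell2 d, fourierT d (damping d α hα (∑ n ∈ s, lp.single 2 n (f n)))
        = ∑ p ∈ P, U f p := by
      intro f
      rw [fourierT_damping_sum, Finset.sum_fiberwise_of_maps_to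
        fun n hn => Finset.mem_image_of_mem _ hn]
    rw [hT, ContinuousLinearMap.comp_apply, inner_damping, ContinuousLinearMap.comp_apply,
      cmultiplier_apply, ← LinearIsometryEquiv.inner_map_map (fourierT d),
      LinearIsometryEquiv.apply_symm_apply, hF, hF, map_sum, sum_inner]
    simp only [inner_sum]
    have hpq : ∀ p q, ‖inner ℂ (U f p) (cmulOp w (U g q))‖
        ≤ K * (((1 + |(p : ℝ)|) ^ β * ‖U f p‖) * ((1 + |(q : ℝ)|) ^ β * ‖U g q‖)) := by
      intro p q
      have h := norm_inner_slice_le (w := w) (j := j) (p := p) (q := q)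
        (u := trigPoly (slice s j p) fun n => ((japanese n ^ (-α) : ℝ) : ℂ) * f n)
        (v := trigPoly (slice s j q) fun n => ((japanese n ^ (-α) : ℝ) : ℂ) * g n)
        (trigPoly_line (fun n hn => (Finset.mem_filter.mp hn).2) _)
        (trigPoly_line (fun n hn => (Finset.mem_filter.mp hn).2) _) (fun k => hw k (p - q))
      rw [toLp_trigPoly, toLp_trigPoly] at h
      have h2 : (1 + |((p - q : ℤ) : ℝ)|) ^ β ≤ (1 + |(p : ℝ)|) ^ β * (1 + |(q : ℝ)|) ^ β := by
        rw [← Real.mul_rpow (by positivity) (by positivity)]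
        refine Real.rpow_le_rpow (by positivity) ?_ hβ
        push_cast
        have := abs_sub (p : ℝ) q
        nlinarith [abs_nonneg (p : ℝ), abs_nonneg (q : ℝ)]
      -- The factor `2π ≥ 1` from averaging over lines is simply discarded.
      have h3 : ‖inner ℂ (U f p) (cmulOp w (U g q))‖
          ≤ 2 * Real.pi * ‖inner ℂ (U f p) (cmulOp w (U g q))‖ :=
        le_mul_of_one_le_left (norm_nonneg _) (by linarith)
      refine h3.trans (h.trans ?_)
      calc K * (1 + |((p - q : ℤ) : ℝ)|) ^ β * (‖U f p‖ * ‖U g q‖)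
          ≤ K * ((1 + |(p : ℝ)|) ^ β * (1 + |(q : ℝ)|) ^ β) * (‖U f p‖ * ‖U g q‖) := by gcongr
        _ = _ := by ring
    have hb : ∀ f : Ell2 d, ∑ p ∈ P, (1 + |(p : ℝ)|) ^ β * ‖U f p‖ ≤ Q * ‖f‖ :=
      sum_weighted_slice_norm_le hα hαβ s j
    calc ‖∑ p ∈ P, ∑ q ∈ P, inner ℂ (U f p) (cmulOp w (U g q))‖
        ≤ ∑ p ∈ P, ∑ q ∈ P,
          K * (((1 + |(p : ℝ)|) ^ β * ‖U f p‖) * ((1 + |(q : ℝ)|) ^ β * ‖U g q‖)) :=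
        norm_sum_le_of_le _ fun p _ => norm_sum_le_of_le _ fun q _ => hpq p q
      _ = K * ((∑ p ∈ P, (1 + |(p : ℝ)|) ^ β * ‖U f p‖)
          * ∑ q ∈ P, (1 + |(q : ℝ)|) ^ β * ‖U g q‖) := by
        simp only [← Finset.mul_sum]
        rw [Finset.sum_mul]
      _ ≤ K * ((Q * ‖f‖) * (Q * ‖g‖)) := by
        refine mul_le_mul_of_nonneg_left (mul_le_mul (hb f) (hb g) ?_ (by positivity)) hK
        exact Finset.sum_nonneg fun q _ => by positivity
      _ = Q ^ 2 * K * ‖f‖ * ‖g‖ := by ring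
  have hlim : ∀ f g : Ell2 d, ‖inner ℂ f (T g)‖ ≤ Q ^ 2 * K * ‖f‖ * ‖g‖ := by
    intro f g
    have hf := lp.hasSum_single (by simp : (2 : ℝ≥0∞) ≠ ⊤) f
    have hg := lp.hasSum_single (by simp : (2 : ℝ≥0∞) ≠ ⊤) g
    have h := (Filter.Tendsto.inner (𝕜 := ℂ) hf ((T.continuous.tendsto g).comp hg)).norm
    exact le_of_tendsto h (Filter.Eventually.of_forall fun s => hfin s f g)
  refine ContinuousLinearMap.opNorm_le_of_re_inner_le (𝕜 := ℂ) (by positivity) fun g f hg hf => ?_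
  refine (RCLike.re_le_norm _).trans ?_
  rw [norm_inner_symm]
  simpa [hf, hg] using hlim f g

/-! ### Boundary values of Hölder continuous functions on the half planes -/

theorem exists_tendsto_of_holder {X : Type*} [NormedAddCommGroup X] [CompleteSpace X] {F : ℝ → X}
    {C β : ℝ} (hβ : 0 < β) (h : ∀ s t, 0 < s → 0 < t → ‖F s - F t‖ ≤ C * |s - t| ^ β) :
    ∃ x, Filter.Tendsto F (nhdsWithin 0 (Set.Ioi 0)) (nhds x) := by
  refine cauchy_map_iff_exists_tendsto.mp (cauchy_map_iff.mpr ⟨inferInstance, ?_⟩)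
  rw [tendsto_uniformity_iff_dist_tendsto_zero]
  set l := nhdsWithin (0 : ℝ) (Set.Ioi 0)
  have hb : Filter.Tendsto (fun p : ℝ × ℝ => C * |p.1 - p.2| ^ β) (l ×ˢ l) (nhds 0) := by
    have h1 : Filter.Tendsto (fun p : ℝ × ℝ => C * |p.1 - p.2| ^ β) (nhds (0, 0)) (nhds 0) := by
      have : Continuous fun p : ℝ × ℝ => C * |p.1 - p.2| ^ β := by
        refine continuous_const.mul (Continuous.rpow_const (by fun_prop) fun _ => Or.inr hβ.le)
      have h2 := this.tendsto (0, 0)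
      simpa [Real.zero_rpow hβ.ne'] using h2
    refine h1.mono_left ?_
    rw [nhds_prod_eq]
    exact Filter.prod_mono nhdsWithin_le_nhds nhdsWithin_le_nhds
  refine squeeze_zero' (Filter.Eventually.of_forall fun _ => dist_nonneg) ?_ hb
  have hl : ∀ᶠ s in l, 0 < s := self_mem_nhdsWithin
  filter_upwards [hl.prod_mk hl] with p hp
  rw [dist_eq_norm]
  exact h _ _ hp.1 hp.2

theorem exists_boundary_values {X : Type*} [NormedAddCommGroup X] [CompleteSpace X] {F : ℂ → X}
    {γ : ℝ} (hγ : 0 < γ)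
    (hF : ∀ β, 0 < β → β < 1 → β < γ → ∃ C, ∀ z z' : ℂ, 0 < z.im * z'.im →
      ‖F z - F z'‖ ≤ C * ‖z - z'‖ ^ β) {σ : ℝ} (hσ : |σ| = 1) :
    ∃ R : ℝ → X,
      (∀ E : ℝ, Filter.Tendsto (fun ε : ℝ => F ((E : ℂ) + σ * (ε * I)))
        (nhdsWithin 0 (Set.Ioi 0)) (nhds (R E))) ∧
      ∀ β, 0 < β → β < 1 → β < γ → ∃ C, ∀ E E' : ℝ, ‖R E - R E'‖ ≤ C * |E - E'| ^ β := by
  have hσ2 : σ * σ = 1 := by rw [← abs_mul_abs_self, hσ, one_mul]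
  have him : ∀ (E E' ε ε' : ℝ), 0 < ε → 0 < ε' →
      0 < ((E : ℂ) + σ * (ε * I)).im * ((E' : ℂ) + σ * (ε' * I)).im := by
    intro E E' ε ε' h h'
    have : ((E : ℂ) + σ * (ε * I)).im * ((E' : ℂ) + σ * (ε' * I)).im = ε * ε' := by
      simp
      linear_combination (ε * ε') * hσ2
    rw [this]
    positivity
  -- Any admissible exponent yields existence of the limits; this one lies below both `1` and `γ`.
  -- The limit `R` is fixed before the Hölder exponent `β` of the conclusion is chosen.
  obtain ⟨C₀, hC₀⟩ := hF (min (1 / 2) (γ / 2)) (by positivity)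
    ((min_le_left _ _).trans_lt (by norm_num)) ((min_le_right _ _).trans_lt (by linarith))
  have hex : ∀ E : ℝ, ∃ x, Filter.Tendsto (fun ε : ℝ => F ((E : ℂ) + σ * (ε * I)))
      (nhdsWithin 0 (Set.Ioi 0)) (nhds x) := by
    intro E
    refine exists_tendsto_of_holder (C := C₀) (β := min (1 / 2) (γ / 2)) (by positivity)
      fun s t hs ht => ?_
    refine (hC₀ _ _ (him E E s t hs ht)).trans (le_of_eq ?_)
    have : (E : ℂ) + σ * (s * I) - (E + σ * (t * I)) = (σ : ℂ) * ((s - t : ℝ) : ℂ) * I := by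
      push_cast
      ring
    rw [this, norm_mul, norm_mul, Complex.norm_real, Complex.norm_real, Complex.norm_I,
      Real.norm_eq_abs, Real.norm_eq_abs, hσ, one_mul, mul_one]
  choose R hR using hex
  refine ⟨R, hR, fun β h0 h1 h2 => ?_⟩
  obtain ⟨C, hC⟩ := hF β h0 h1 h2
  refine ⟨C, fun E E' => ?_⟩
  refine le_of_tendsto ((hR E).sub (hR E')).norm ?_
  filter_upwards [self_mem_nhdsWithin] with ε hε
  refine (hC _ _ (him E E' ε ε hε hε)).trans (le_of_eq ?_)
  have : (E : ℂ) + σ * (ε * I) - (E' + σ * (ε * I)) = ((E - E' : ℝ) : ℂ) := by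
    push_cast
    ring
  rw [this, Complex.norm_real, Real.norm_eq_abs]

/-! ### The limiting absorption principle -/

/-- The partition of `ρ` splits the difference of resolvents into one multiplier per direction, and
each is estimated by slicing in its own direction `j`. -/
theorem exists_holder_dampedResolvent (hd : 0 < d) {H : Ell2 d →L[ℂ] Ell2 d} {ℰ ρ : C(Torus d, ℝ)}
    (hH : HasSymbol H ℰ) (hℰ : TorusSmooth ℰ) (hρ : TorusSmooth ρ)
    (hsupp : ∀ k ∈ tsupport (ρ : Torus d → ℝ), ¬ IsCriticalPoint ℰ k) {α : ℝ} (hα : 0 ≤ α)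
    {β : ℝ} (hβ0 : 0 ≤ β) (hβ1 : β ≤ 1) (hαβ : β < α - 1 / 2) :
    ∃ C, ∀ z z' : ℂ, 0 < z.im * z'.im →
      ‖dampedResolvent H ρ α hα z - dampedResolvent H ρ α hα z'‖ ≤ C * ‖z - z'‖ ^ β := by
  obtain ⟨c, hc, g, hg, hgc, hsum⟩ := exists_smooth_partition hd hℰ hρ hsupp
  choose B hB0 hB using fun j => exists_norm_integral_line_sub_le hℰ (hg j) hc (hgc j)
  set Q := (2 ^ α * Real.sqrt (weightSum (β - α))) ^ 2 with hQ
  refine ⟨∑ j, Q * B j, fun z z' hzz => ?_⟩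
  have hz : z.im ≠ 0 := by rintro h; simp [h] at hzz
  have hz' : z'.im ≠ 0 := by rintro h; simp [h] at hzz
  set w : Fin d → C(Torus d, ℂ) := fun j =>
    toComplex ⟨fun k => g j k * partialDeriv j ℰ k, ((hg j).mul (hℰ.partialDeriv j)).continuous⟩
      * (resolventSymbol ℰ hz - resolventSymbol ℰ hz') with hw
  have hwsum : toComplex ρ * resolventSymbol ℰ hz - toComplex ρ * resolventSymbol ℰ hz'
      = ∑ j, w j := by
    rw [← mul_sub, hw, ← Finset.sum_mul]
    congr 1
    ext k
    rw [ContinuousMap.sum_apply]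
    change ((ρ k : ℝ) : ℂ) = ∑ j, ((g j k * partialDeriv j ℰ k : ℝ) : ℂ)
    rw [hsum]
    push_cast
    rfl
  have hdiff : dampedResolvent H ρ α hα z - dampedResolvent H ρ α hα z'
      = ∑ j, damping d α hα ∘L cmultiplier (w j) ∘L damping d α hα := by
    have h1 : ∑ j, damping d α hα ∘L cmultiplier (w j) ∘L damping d α hα
        = damping d α hα ∘L cmultiplier (∑ j, w j) ∘L damping d α hα := by
      rw [cmultiplier_sum]
      ext1 φ
      simp
    rw [h1, ← hwsum, cmultiplier_sub, cmultiplier_mul, cmultiplier_mul, dampedResolvent,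
      dampedResolvent, resolventOp_eq_cmultiplier hH hz, resolventOp_eq_cmultiplier hH hz',
      fourierMultiplier_eq_cmultiplier]
    ext1 φ
    simp
  rw [hdiff, Finset.sum_mul]
  refine norm_sum_le_of_le _ fun j _ => ?_
  rw [mul_assoc]
  refine norm_damping_cmultiplier_damping_le hα hβ0 hαβ (mul_nonneg (hB0 j) (by positivity))
    (j := j) fun k x => ?_
  refine le_of_eq_of_le ?_ ((hB j β hβ0 hβ1 k x z z' hzz).trans (le_of_eq (by ring)))
  congr 1
  refine intervalIntegral.integral_congr fun t _ => ?_
  simp only [hw, ContinuousMap.mul_apply, ContinuousMap.sub_apply, toComplex, resolventSymbol,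
    ContinuousMap.coe_mk]
  ring

end LAP

theorem mainTheorem3 (d : ℕ) (hd : 2 ≤ d)
    (H : LAP.Ell2 d →L[ℂ] LAP.Ell2 d) (hH : IsSelfAdjoint H)
    (hHtrans : LAP.TranslationInvariant H)
    (ℰ : C(LAP.Torus d, ℝ)) (hHℰ : LAP.HasSymbol H ℰ)
    (hℰ : AnalyticOnNhd ℝ (LAP.lift ℰ) Set.univ)
    (ρ : C(LAP.Torus d, ℝ)) (hρ : ContDiff ℝ ((⊤ : ℕ∞) : WithTop ℕ∞) (LAP.lift ρ))
    (hρ01 : ∀ k, ρ k ∈ Set.Icc (0 : ℝ) 1)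
    (hsupp : ∀ k ∈ tsupport (ρ : LAP.Torus d → ℝ), ¬ LAP.IsCriticalPoint ℰ k)
    (α : ℝ) (hα : 1 / 2 < α) :
    ∃ Rplus Rminus : ℝ → (LAP.Ell2 d →L[ℂ] LAP.Ell2 d),
      (∀ E : ℝ,
        Filter.Tendsto
          (fun ε : ℝ => LAP.dampedResolvent H ρ α (one_half_pos.trans hα).le
            ((E : ℂ) + (ε : ℂ) * Complex.I))
          (nhdsWithin 0 (Set.Ioi 0)) (nhds (Rplus E))) ∧
      (∀ E : ℝ,
        Filter.Tendsto
          (fun ε : ℝ => LAP.dampedResolvent H ρ α (one_half_pos.trans hα).le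
            ((E : ℂ) - (ε : ℂ) * Complex.I))
          (nhdsWithin 0 (Set.Ioi 0)) (nhds (Rminus E))) ∧
      (∀ β : ℝ, 0 < β → β < 1 → β < α - 1 / 2 →
        ∃ C : ℝ, ∀ E E' : ℝ,
          ‖Rplus E - Rplus E'‖ ≤ C * |E - E'| ^ β ∧
          ‖Rminus E - Rminus E'‖ ≤ C * |E - E'| ^ β) := by
  have hd0 : 0 < d := by omega
  have hα0 : 0 ≤ α := (one_half_pos.trans hα).le
  have hℰs : LAP.TorusSmooth ℰ :=
    (contDiffOn_univ.mp (hℰ.contDiffOn (n := ((⊤ : ℕ∞) : WithTop ℕ∞)) uniqueDiffOn_univ))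
  have hF := fun β (h0 : 0 < β) (h1 : β < 1) (h2 : β < α - 1 / 2) =>
    LAP.exists_holder_dampedResolvent hd0 hHℰ hℰs hρ hsupp hα0 h0.le h1.le h2
  obtain ⟨Rp, hRp, hRp'⟩ := LAP.exists_boundary_values (sub_pos.mpr hα) hF (σ := 1) (by simp)
  obtain ⟨Rm, hRm, hRm'⟩ := LAP.exists_boundary_values (sub_pos.mpr hα) hF (σ := -1) (by simp)
  refine ⟨Rp, Rm, fun E => ?_, fun E => ?_, fun β h0 h1 h2 => ?_⟩
  · simpa using hRp E
  · simpa [sub_eq_add_neg] using hRm E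
  · obtain ⟨C, hC⟩ := hRp' β h0 h1 h2
    obtain ⟨C', hC'⟩ := hRm' β h0 h1 h2
    refine ⟨max C C', fun E E' => ⟨(hC E E').trans ?_, (hC' E E').trans ?_⟩⟩
    · gcongr
      exact le_max_left _ _
    · gcongr
      exact le_max_right _ _
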